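/- All Hilbert spaces are finite-dimensional and $\log$ is taken in base 2. $\mathcal S_{\le}(\mathcal H)$ denotes the set of positive semidefinite operators on $\mathcal H$ with trace at most $1$. For positive semidefinite $R,S$ let $F(R,S)=\|\sqrt R\sqrt S\|_1$, where $\|T\|_1=\operatorname{tr}\sqrt{T^\dagger T}$. For $\rho,\sigma\in\mathcal S_{\le}(\mathcal H)$ the purified distance is $$P(\rho,\sigma)=\sqrt{1-\bar F(\rho,\sigma)^2},\qquad \bar F(\rho,\sigma)=F(\rho,\sigma)+\sqrt{(1-\operatorname{tr}\rho)(1-\operatorname{tr}\sigma)} .$$ For $\rho_{AB}\in\mathcal S_{\le}(\mathcal H_A\otimes\mathcal H_B)$ define $$H_{\min}(A|B)_\rho=\sup_{\sigma_B\in\mathcal S_{\le}(\mathcal H_B)}\ \sup\{\lambda\in\mathbb R:\rho_{AB}\le 2^{-\lambda}\,\mathrm{id}_A\otimes\sigma_B\},$$ $$H_{\max}(A|B)_\rho=\sup_{\sigma_B\in\mathcal S_{\le}(\mathcal H_B)}\log F(\rho_{AB},\mathrm{id}_A\otimes\sigma_B)^2,$$ with values in $[-\infty,\infty]$ and $\log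 0=-\infty$; and, for $\varepsilon\ge0$, $$H^\varepsilon_{\min}(A|B)_\rho=\sup_{\tilde\rho}H_{\min}(A|B)_{\tilde\rho},\qquad H^\varepsilon_{\max}(A|B)_\rho=\inf_{\tilde\rho}H_{\max}(A|B)_{\tilde\rho},$$ where $\tilde\rho$ ranges over all $\tilde\rho\in\mathcal S_{\le}(\mathcal H_A\otimes\mathcal H_B)$ with $P(\tilde\rho,\rho)\le\varepsilon$. For a state on more systems, entropies that do not involve all of them are those of the reduced state (partial trace). Let $f(\varepsilon)=\log\frac1{1-\sqrt{1-\varepsilon^2}}$. **Statement.** Let $\varepsilon',\varepsilon'',\varepsilon'''\ge0$ and $\rho_{ABC}\in\mathcal S_{\le}(\mathcal H_A\otimes\mathcal H_B\otimes\mathcal H_C)$ be such that $\varepsilon'+2\varepsilon''+\varepsilon'''<1-2\sqrt{1-\operatorname{tr}\rho}$. Then $$H_{\min}^{\varepsilon'}(AB|C)_\rho\le H_{\max}^{\varepsilon'''}(A|BC)_\rho+H_{\max}^{\varepsilon''}(B|C)_\rho+g(\varepsilon',\varepsilon'',\varepsilon''',\operatorname{tr}\rho),$$ where $$g(\varepsilon',\varepsilon'',\varepsilon''',\operatorname{tr}\rho)=\inf_{\varepsilon}\left\{2f(\varepsilon)+\log\frac{1}{1-\left(\varepsilon+\varepsilon'+2\varepsilon''+\varepsilon'''+2\sqrt{1-\operatorname{tr}\rho}\right)^2}\right\},$$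 the infimum being over $0<\varepsilon<1-\varepsilon'-2\varepsilon''-\varepsilon'''-2\sqrt{1-\operatorname{tr}\rho}$. Moreover, if $\operatorname{tr}\rho_{ABC}=1$, then $$H_{\min}(AB|C)_\rho\le H_{\max}(A|BC)_\rho+H_{\max}(B|C)_\rho+4 .$$ -/

import Mathlib

open scoped Kronecker MatrixOrder ComplexOrder

noncomputable section

/-! Operators on a finite-dimensional Hilbert space are written as complex matrices with respect
to a fixed orthonormal basis, indexed by a finite type; the tensor product of the spaces indexed by
`X` and `Y` is indexed by `X × Y`. Logarithms are in base 2. Entropies take values in `EReal`, so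
that suprema, infima and `log 0 = ⊥` need no convention. -/

namespace SmoothEntropy

variable {X Y A B C : Type*} [Fintype X] [DecidableEq X] [Fintype Y] [DecidableEq Y]
  [Fintype A] [Fintype B] [Fintype C]

/-- The trace as a real number (used for positive semidefinite operators). -/
def rtr (R : Matrix X X ℂ) : ℝ := R.trace.re

/-- `𝒮_≤`: positive semidefinite operators of trace at most one. -/
def SubNormalized (X : Type*) [Fintype X] : Set (Matrix X X ℂ) :=
  {R | R.PosSemidef ∧ rtr R ≤ 1}

/-- `𝒮_=`: positive semidefinite operators of trace one. -/
def Normalized (X : Type*) [Fintype X] : Set (Matrix X X ℂ) :=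
  {R | R.PosSemidef ∧ rtr R = 1}

/-- The trace norm `‖R‖₁ = tr √(R† R)`. -/
def traceNorm (R : Matrix X X ℂ) : ℝ := rtr (CFC.sqrt (R.conjTranspose * R))

/-- The fidelity `F(R, S) = ‖√R √S‖₁` of positive semidefinite operators. -/
def fidelity (R S : Matrix X X ℂ) : ℝ := traceNorm (CFC.sqrt R * CFC.sqrt S)

/-- The generalized fidelity `F(R, S) + √((1 - tr R) (1 - tr S))`. -/
def genFidelity (R S : Matrix X X ℂ) : ℝ :=
  fidelity R S + Real.sqrt ((1 - rtr R) * (1 - rtr S))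

/-- The purified distance. -/
def purifiedDist (R S : Matrix X X ℂ) : ℝ := Real.sqrt (1 - genFidelity R S ^ 2)

/-- The sub-normalized states that are `ε`-close to `R` in purified distance. -/
def closeStates (ε : ℝ) (R : Matrix X X ℂ) : Set (Matrix X X ℂ) :=
  {S | S ∈ SubNormalized X ∧ purifiedDist S R ≤ ε}

/-- Base-2 logarithm of a nonnegative real number, with `log 0 = -∞`. -/
def elog2 (x : ℝ) : EReal := if x ≤ 0 then ⊥ else (Real.logb 2 x : EReal)

/-- `H_min(X|Y)_{ρ|σ} = sup {l : ρ_XY ≤ 2^(-l) id_X ⊗ σ_Y}`. -/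
def HminRel (ρ : Matrix (X × Y) (X × Y) ℂ) (σ : Matrix Y Y ℂ) : EReal :=
  sSup {e : EReal | ∃ l : ℝ, e = (l : EReal) ∧
    ρ ≤ (2 : ℝ) ^ (-l) • ((1 : Matrix X X ℂ) ⊗ₖ σ)}

/-- The min-entropy `H_min(X|Y)_ρ`. -/
def Hmin (ρ : Matrix (X × Y) (X × Y) ℂ) : EReal :=
  ⨆ σ ∈ SubNormalized Y, HminRel ρ σ

/-- `H_max(X|Y)_{ρ|σ} = log F(ρ_XY, id_X ⊗ σ_Y)²`. -/
def HmaxRel (ρ : Matrix (X × Y) (X × Y) ℂ) (σ : Matrix Y Y ℂ) : EReal :=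
  elog2 (fidelity ρ ((1 : Matrix X X ℂ) ⊗ₖ σ) ^ 2)

/-- The max-entropy `H_max(X|Y)_ρ`. -/
def Hmax (ρ : Matrix (X × Y) (X × Y) ℂ) : EReal :=
  ⨆ σ ∈ SubNormalized Y, HmaxRel ρ σ

/-- The `ε`-smooth min-entropy `H_min^ε(X|Y)_ρ`. -/
def HminSmooth (ε : ℝ) (ρ : Matrix (X × Y) (X × Y) ℂ) : EReal :=
  ⨆ ρ' ∈ closeStates ε ρ, Hmin ρ'

/-- The `ε`-smooth max-entropy `H_max^ε(X|Y)_ρ`. -/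
def HmaxSmooth (ε : ℝ) (ρ : Matrix (X × Y) (X × Y) ℂ) : EReal :=
  ⨅ ρ' ∈ closeStates ε ρ, Hmax ρ'

/-- `ρ_ABC` as an operator on the bipartite system `(AB) C`; as an operator on `A (BC)` it is `ρ`
itself. -/
def regroup (ρ : Matrix (A × B × C) (A × B × C) ℂ) :
    Matrix ((A × B) × C) ((A × B) × C) ℂ :=
  ρ.submatrix (Equiv.prodAssoc A B C) (Equiv.prodAssoc A B C)

/-- The partial trace over the first system: `ρ_Y = tr_X ρ_XY`. -/
def trFst (ρ : Matrix (X × Y) (X × Y) ℂ) : Matrix Y Y ℂ :=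
  Matrix.of fun y y' => ∑ x, ρ (x, y) (x, y')

/-- `f(ε) = log (1 / (1 - √(1 - ε²)))`. -/
def f (ε : ℝ) : ℝ := Real.logb 2 (1 / (1 - Real.sqrt (1 - ε ^ 2)))

/-- `g(ε', ε'', ε''', t)`, the infimum over
`0 < ε < 1 - ε' - 2 ε'' - ε''' - 2 √(1 - t)` of
`2 f(ε) + log (1 / (1 - (ε + ε' + 2 ε'' + ε''' + 2 √(1 - t))²))`. -/
def g (ε' ε'' ε''' t : ℝ) : EReal :=
  ⨅ ε ∈ Set.Ioo (0 : ℝ) (1 - ε' - 2 * ε'' - ε''' - 2 * Real.sqrt (1 - t)),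
    ((2 * f ε + Real.logb 2
      (1 / (1 - (ε + ε' + 2 * ε'' + ε''' + 2 * Real.sqrt (1 - t)) ^ 2)) : ℝ) : EReal)

end SmoothEntropy

end

noncomputable section

namespace SmoothEntropy

open Matrix

/-! ### Trace norm, Hölder's inequality and angles between unit vectors. -/

section TraceNorm

variable {X : Type*} [Fintype X]

/-! Fix `ε`, states ρ₁, ρ₃ close to ρ_ABC and ρ₂ close to ρ_BC, with ρ₁ ≤ k · id ⊗ σ_C and k =
2^(-l), and put T = id_B ⊗ σ_C. Both sides of the chain rule are compared through one number, the
overlap of two square roots N₁, N₃ of (parts of) ρ₁ and ρ₃ with a projector id_A ⊗ Q inserted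
between them, where Q acts on BC.

Q is a spectral projector separating ρ₂ from T: tr(QT) is at most F(ρ₂,T)²/p, while 1 - Q has weight
at most p = 1 - √(1 - ε²) on ρ₂ (`exists_projector_rtr_le`).

Upper bound: compressing ρ₁ by Q gives an operator below k · id_A ⊗ QTQ. After normalising QTQ to a
state τ_BC, Hölder's inequality bounds the squared overlap by k · tr(QT) · F(ρ₃, id ⊗ τ)²
(`rtr_conj_mul_le_fidelity`), hence by 2^(-l) · 2^H_max(B|C) / p · 2^H_max(A|BC).

Lower bound: the matrices, padded to unit vectors, obey the triangle inequality for angles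
(`arccos_overlap_le`, `arccos_projector_le`). The angle of the overlap is at most a sum of arcsines
of `ε`, ε', ε'' (twice), ε''' and 2√(1 - tr ρ). Arcsine is superadditive, so the squared overlap is
at least 1 - S², where S is the sum of these arguments.

Together these give `one_sub_sq_le`. Taking logarithms and then optimising over σ, `ε` and the three
smoothing balls gives the theorem. -/

theorem rtr_add (M N : Matrix X X ℂ) : rtr (M + N) = rtr M + rtr N := by simp [rtr]

theorem rtr_sub (M N : Matrix X X ℂ) : rtr (M - N) = rtr M - rtr N := by simp [rtr]

theorem rtr_smul (c : ℝ) (M : Matrix X X ℂ) : rtr (c • M) = c * rtr M := by simp [rtr]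

theorem rtr_zero : rtr (0 : Matrix X X ℂ) = 0 := by simp [rtr]

theorem rtr_mul_comm (M N : Matrix X X ℂ) : rtr (M * N) = rtr (N * M) := by
  rw [rtr, trace_mul_comm, rtr]

theorem rtr_conjTranspose (M : Matrix X X ℂ) : rtr Mᴴ = rtr M := by simp [rtr, trace_conjTranspose]

theorem rtr_nonneg {M : Matrix X X ℂ} (h : 0 ≤ M) : 0 ≤ rtr M :=
  (Complex.le_def.1 (nonneg_iff_posSemidef.1 h).trace_nonneg).1

theorem rtr_mono {M N : Matrix X X ℂ} (h : M ≤ N) : rtr M ≤ rtr N := by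
  have := rtr_nonneg (sub_nonneg.2 h)
  rw [rtr_sub] at this
  linarith

theorem conj_mono {M N : Matrix X X ℂ} (h : M ≤ N) (K : Matrix X X ℂ) :
    K * M * Kᴴ ≤ K * N * Kᴴ := star_right_conjugate_le_conjugate h K

theorem conj_mono' {M N : Matrix X X ℂ} (h : M ≤ N) (K : Matrix X X ℂ) :
    Kᴴ * M * K ≤ Kᴴ * N * K := star_left_conjugate_le_conjugate h K

theorem mul_conjTranspose_nonneg (M : Matrix X X ℂ) : 0 ≤ M * Mᴴ := mul_star_self_nonneg M

theorem conjTranspose_mul_nonneg (M : Matrix X X ℂ) : 0 ≤ Mᴴ * M := star_mul_self_nonneg M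

/-- The vector with entries two matrices and four real numbers. -/
def vec (M N : Matrix X X ℂ) (s : Fin 4 → ℝ) : EuclideanSpace ℂ (((X × X) ⊕ (X × X)) ⊕ Fin 4) :=
  WithLp.toLp 2 (Sum.elim (Sum.elim (fun p => M p.1 p.2) (fun p => N p.1 p.2)) (fun i => (s i : ℂ)))

theorem re_inner_vec (M N M' N' : Matrix X X ℂ) (s s' : Fin 4 → ℝ) :
    (inner ℂ (vec M N s) (vec M' N' s')).re =
      rtr (Mᴴ * M') + rtr (Nᴴ * N') + ∑ i, s i * s' i := by
  have key : ∀ M M' : Matrix X X ℂ,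
      (∑ p : X × X, inner ℂ (M p.1 p.2) (M' p.1 p.2)).re = rtr (Mᴴ * M') := by
    intro M M'
    rw [rtr, trace, Fintype.sum_prod_type, Finset.sum_comm]
    simp [mul_apply, mul_comm]
  rw [PiLp.inner_apply, Fintype.sum_sum_type, Fintype.sum_sum_type, Complex.add_re, Complex.add_re]
  simp only [vec, Sum.elim_inl, Sum.elim_inr, key]
  simp [mul_comm]

/-- The real part of the complex inner product is a real inner product, and angles in a real inner
product space satisfy the triangle inequality. -/
theorem arccos_triangle {E : Type*} [NormedAddCommGroup E] [InnerProductSpace ℂ E] {x y z : E}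
    (hx : (inner ℂ x x).re = 1) (hy : (inner ℂ y y).re = 1) (hz : (inner ℂ z z).re = 1) :
    Real.arccos (inner ℂ x z).re ≤
      Real.arccos (inner ℂ x y).re + Real.arccos (inner ℂ y z).re := by
  let _ : InnerProductSpace ℝ E := InnerProductSpace.complexToReal
  have hn : ∀ w : E, (inner ℂ w w).re = 1 → ‖w‖ = 1 := by
    intro w hw
    have : (inner ℂ w w).re = ‖w‖ ^ 2 := inner_self_eq_norm_sq (𝕜 := ℂ) w
    rw [this] at hw
    nlinarith [norm_nonneg w]
  have hi : ∀ a b : E, inner ℝ a b = (inner ℂ a b).re := fun _ _ => rfl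
  have := InnerProductGeometry.angle_le_angle_add_angle x y z
  simpa [InnerProductGeometry.angle, hn x hx, hn y hy, hn z hz, hi] using this

theorem rtr_conjTranspose_mul_le (M N : Matrix X X ℂ) :
    rtr (Mᴴ * N) ≤ Real.sqrt (rtr (Mᴴ * M)) * Real.sqrt (rtr (Nᴴ * N)) := by
  have h := re_inner_le_norm (𝕜 := ℂ) (vec M 0 0) (vec N 0 0)
  have hn : ∀ M : Matrix X X ℂ, ‖vec M 0 0‖ = Real.sqrt (rtr (Mᴴ * M)) := by
    intro M
    rw [norm_eq_sqrt_re_inner (𝕜 := ℂ)]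
    congr 1
    exact (re_inner_vec M 0 M 0 0 0).trans (by simp [rtr_zero])
  rw [hn, hn] at h
  refine le_trans (le_of_eq ?_) h
  exact ((re_inner_vec M 0 N 0 0 0).trans (by simp [rtr_zero])).symm

variable [DecidableEq X]

theorem conjTranspose_sqrt (M : Matrix X X ℂ) : (CFC.sqrt M)ᴴ = CFC.sqrt M :=
  (nonneg_iff_posSemidef.1 (CFC.sqrt_nonneg M)).1

theorem continuousOn_spectrum (g : ℝ → ℝ) (M : Matrix X X ℂ) : ContinuousOn g (spectrum ℝ M) :=
  finite_real_spectrum.continuousOn g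

theorem cfc_mul_cfc (g h : ℝ → ℝ) (M : Matrix X X ℂ) :
    cfc g M * cfc h M = cfc (fun x => g x * h x) M :=
  (cfc_mul g h M (continuousOn_spectrum _ _) (continuousOn_spectrum _ _)).symm

theorem conjTranspose_cfc (g : ℝ → ℝ) (M : Matrix X X ℂ) : (cfc g M)ᴴ = cfc g M :=
  (cfc_predicate g M : IsSelfAdjoint _)

theorem cfc_le_cfc {g h : ℝ → ℝ} {M : Matrix X X ℂ} (H : ∀ x, 0 ≤ x → g x ≤ h x) (hM : 0 ≤ M) :
    cfc g M ≤ cfc h M :=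
  cfc_mono (fun x hx => H x (spectrum_nonneg_of_nonneg hM hx)) (continuousOn_spectrum _ _)
    (continuousOn_spectrum _ _)

theorem cfc_congr_nonneg {g h : ℝ → ℝ} {M : Matrix X X ℂ} (H : ∀ x, 0 ≤ x → g x = h x)
    (hM : 0 ≤ M) : cfc g M = cfc h M :=
  cfc_congr fun x hx => H x (spectrum_nonneg_of_nonneg hM hx)

theorem cfc_id_eq {M : Matrix X X ℂ} (hM : 0 ≤ M) : cfc (fun x : ℝ => x) M = M :=
  cfc_id' ℝ M hM.isSelfAdjoint

/-- The trace norm is attained at a contraction. -/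
theorem exists_contraction_rtr_eq_traceNorm (T : Matrix X X ℂ) :
    ∃ C : Matrix X X ℂ, C * Cᴴ ≤ 1 ∧ rtr (C * T) = traceNorm T := by
  set H := CFC.sqrt (Tᴴ * T) with hH
  have H0 : 0 ≤ H := CFC.sqrt_nonneg _
  have HH : H * H = Tᴴ * T := CFC.sqrt_mul_sqrt_self _ (conjTranspose_mul_nonneg T)
  -- The adjoint of the partial isometry in the polar decomposition of T. Since 0⁻¹ = 0, the
  -- functional calculus yields the pseudo-inverse of |T|.
  refine ⟨cfc (fun x : ℝ => x⁻¹) H * Tᴴ, ?_, ?_⟩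
  · rw [conjTranspose_mul, conjTranspose_conjTranspose, conjTranspose_cfc, Matrix.mul_assoc,
      ← Matrix.mul_assoc Tᴴ, ← HH]
    conv_lhs =>
      enter [2, 1]
      rw [← cfc_id_eq H0]
    rw [cfc_mul_cfc, cfc_mul_cfc, cfc_mul_cfc, ← cfc_one ℝ H]
    refine cfc_le_cfc (fun x hx => ?_) H0
    rcases eq_or_ne x 0 with rfl | h
    · simp
    · field_simp; simp
  · rw [Matrix.mul_assoc, ← HH, traceNorm, ← hH]
    congr 1
    conv_lhs =>
      enter [2]
      rw [← cfc_id_eq H0]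
    rw [cfc_mul_cfc, cfc_mul_cfc]
    conv_rhs => rw [← cfc_id_eq H0]
    refine cfc_congr_nonneg (fun x hx => ?_) H0
    rcases eq_or_ne x 0 with rfl | h
    · simp
    · field_simp

/-- Hölder's inequality between the operator norm and the trace norm. -/
theorem rtr_mul_le_traceNorm {K T : Matrix X X ℂ} {κ : ℝ} (hκ : 0 ≤ κ)
    (hK : Kᴴ * K ≤ κ • (1 : Matrix X X ℂ)) : rtr (K * T) ≤ Real.sqrt κ * traceNorm T := by
  set H := CFC.sqrt (Tᴴ * T) with hH
  have H0 : 0 ≤ H := CFC.sqrt_nonneg _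
  have HH : H * H = Tᴴ * T := CFC.sqrt_mul_sqrt_self _ (conjTranspose_mul_nonneg T)
  have Hid := cfc_id_eq H0
  set r := cfc Real.sqrt H with hr
  set w := cfc (fun x : ℝ => (Real.sqrt x)⁻¹) H with hw
  have hrr : rᴴ * r = H := by
    rw [hr, conjTranspose_cfc, cfc_mul_cfc]
    conv_rhs => rw [← Hid]
    exact cfc_congr_nonneg (fun x hx => Real.mul_self_sqrt hx) H0
  have hww : wᴴ * (H * H) * w = H := by
    have : H * H = cfc (fun x : ℝ => x * x) H := by
      rw [← cfc_mul_cfc, Hid]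
    rw [this, hw, conjTranspose_cfc, cfc_mul_cfc, cfc_mul_cfc]
    conv_rhs => rw [← Hid]
    refine cfc_congr_nonneg (fun x hx => ?_) H0
    rcases eq_or_ne x 0 with rfl | h
    · simp
    · have h1 : Real.sqrt x ≠ 0 := (Real.sqrt_pos.2 (lt_of_le_of_ne hx h.symm)).ne'
      have h2 := Real.sq_sqrt hx
      field_simp
      rw [h2]
  -- The product of w = |T|^(-1/2) and r = |T|^(1/2) is the support projector of |T|. Cauchy–Schwarz
  -- is then applied to r and K T w, whose squared norms are at most tr |T| and κ tr |T|.
  have hT : T * (w * r) = T := by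
    have h0 : T * (w * r - 1) = 0 := by
      rw [← conjTranspose_mul_self_eq_zero, conjTranspose_mul, Matrix.mul_assoc,
        ← Matrix.mul_assoc Tᴴ, ← HH]
      have : w * r - 1 = cfc (fun x : ℝ => (Real.sqrt x)⁻¹ * Real.sqrt x - 1) H := by
        rw [cfc_sub _ _ _ (continuousOn_spectrum _ _) (continuousOn_spectrum _ _), cfc_mul_cfc]
        congr 1
        exact (cfc_one ℝ H).symm
      have hz : H * (w * r - 1) = 0 := by
        rw [this]
        conv_lhs => enter [1]; rw [← Hid]
        rw [cfc_mul_cfc, ← cfc_zero ℝ H]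
        refine cfc_congr_nonneg (fun x hx => ?_) H0
        rcases eq_or_ne x 0 with rfl | h
        · simp
        · have h1 : Real.sqrt x ≠ 0 := (Real.sqrt_pos.2 (lt_of_le_of_ne hx h.symm)).ne'
          simp [h1]
      rw [Matrix.mul_assoc H, hz, Matrix.mul_zero, Matrix.mul_zero]
    rw [Matrix.mul_sub, Matrix.mul_one, sub_eq_zero] at h0
    exact h0
  have h1 : rtr (K * T) = rtr (rᴴ * (K * T * w)) := by
    have : rᴴ = r := conjTranspose_cfc _ _
    rw [this, rtr_mul_comm r, Matrix.mul_assoc (K * T), Matrix.mul_assoc K, hT]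
  have h2 : rtr ((K * T * w)ᴴ * (K * T * w)) ≤ κ * rtr H := by
    have e : (K * T * w)ᴴ * (K * T * w) = wᴴ * (Tᴴ * (Kᴴ * K) * T) * w := by
      simp only [conjTranspose_mul, Matrix.mul_assoc]
    have e2 : wᴴ * (Tᴴ * (κ • (1 : Matrix X X ℂ)) * T) * w = κ • H := by
      simp only [Matrix.mul_smul, Matrix.smul_mul, Matrix.mul_one]
      rw [← HH, hww]
    rw [e, ← rtr_smul, ← e2]
    exact rtr_mono (conj_mono' (conj_mono' hK T) w)
  rw [h1]
  refine (rtr_conjTranspose_mul_le _ _).trans ?_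
  rw [hrr]
  calc _ ≤ Real.sqrt (rtr H) * Real.sqrt (κ * rtr H) := by gcongr
    _ = Real.sqrt κ * rtr H := by
      rw [Real.sqrt_mul hκ, mul_left_comm, Real.mul_self_sqrt (rtr_nonneg H0)]

theorem traceNorm_nonneg (T : Matrix X X ℂ) : 0 ≤ traceNorm T := rtr_nonneg (CFC.sqrt_nonneg _)

/-- With D = κ - K†K, one has κD - D² = K†(κ - KK†)K ≥ 0, so κD ≥ D² ≥ 0. -/
theorem conjTranspose_mul_le_of_mul_conjTranspose_le {K : Matrix X X ℂ} {κ : ℝ} (hκ : 0 < κ)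
    (hK : K * Kᴴ ≤ κ • (1 : Matrix X X ℂ)) : Kᴴ * K ≤ κ • (1 : Matrix X X ℂ) := by
  set D := κ • (1 : Matrix X X ℂ) - Kᴴ * K with hD
  have hDD : Dᴴ = D := by simp [hD, conjTranspose_sub, conjTranspose_smul]
  have h1 : Kᴴ * (K * Kᴴ) * K ≤ κ • (Kᴴ * K) := by
    simpa [Matrix.mul_smul, Matrix.smul_mul] using conj_mono' hK K
  have h2 : D * Dᴴ ≤ κ • D := by
    rw [hDD, ← sub_nonneg]
    have e : κ • D - D * D = κ • (Kᴴ * K) - Kᴴ * (K * Kᴴ) * K := by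
      simp only [hD, Matrix.mul_sub, Matrix.sub_mul, Matrix.mul_smul, Matrix.smul_mul, smul_sub,
        Matrix.mul_one, Matrix.one_mul, Matrix.mul_assoc]
      abel
    rw [e, sub_nonneg]
    exact h1
  have h3 : 0 ≤ κ • D := (mul_conjTranspose_nonneg D).trans h2
  have h4 : 0 ≤ κ⁻¹ • (κ • D) := by
    rw [nonneg_iff_posSemidef] at h3 ⊢
    exact h3.smul (inv_nonneg.2 hκ.le)
  rw [inv_smul_smul₀ hκ.ne'] at h4
  exact sub_nonneg.1 h4

end TraceNorm

/-! ### Fidelity: optimal contractions, Hölder bound and separating projectors. -/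

section Fidelity

variable {X : Type*} [Fintype X] [DecidableEq X]

theorem sqrt_mul_sqrt {R : Matrix X X ℂ} (hR : 0 ≤ R) : CFC.sqrt R * CFC.sqrt R = R :=
  CFC.sqrt_mul_sqrt_self R hR

theorem isUnit_sqrt_det {S : Matrix X X ℂ} (hS : S.PosDef) : IsUnit (CFC.sqrt S).det :=
  (isUnit_iff_isUnit_det _).1
    (isStrictlyPositive_iff_posDef.1 (isStrictlyPositive_iff_posDef.2 hS).sqrt).isUnit

theorem conjTranspose_inv_sqrt (S : Matrix X X ℂ) : (CFC.sqrt S)⁻¹ᴴ = (CFC.sqrt S)⁻¹ := by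
  rw [conjTranspose_nonsing_inv, conjTranspose_sqrt]

/-- The fidelity is attained at the image of `√R` under a contraction. -/
theorem exists_contraction_rtr_eq_fidelity (R S : Matrix X X ℂ) :
    ∃ K : Matrix X X ℂ, K * Kᴴ ≤ 1 ∧
      rtr ((CFC.sqrt R * K)ᴴ * CFC.sqrt S) = fidelity R S := by
  obtain ⟨C, hC, h⟩ := exists_contraction_rtr_eq_traceNorm (CFC.sqrt R * CFC.sqrt S)
  refine ⟨Cᴴ, ?_, ?_⟩
  · have := conjTranspose_mul_le_of_mul_conjTranspose_le (K := C) one_pos (by simpa using hC)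
    simpa using this
  · rw [conjTranspose_mul, conjTranspose_conjTranspose, conjTranspose_sqrt, fidelity, ← h,
      Matrix.mul_assoc]

theorem sqrt_mul_contraction_le {R K : Matrix X X ℂ} (hR : 0 ≤ R) (hK : K * Kᴴ ≤ 1) :
    (CFC.sqrt R * K) * (CFC.sqrt R * K)ᴴ ≤ R := by
  have := conj_mono hK (CFC.sqrt R)
  rw [Matrix.mul_one, conjTranspose_sqrt, sqrt_mul_sqrt hR] at this
  rwa [conjTranspose_mul, conjTranspose_sqrt, Matrix.mul_assoc, ← Matrix.mul_assoc K,
    ← Matrix.mul_assoc]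

/-- The domination of GG† lets G be written as √S J with JJ† ≤ κ. The trace then becomes that of an
operator of norm at most √κ against √ρ √S, and Hölder's inequality applies. This is the upper bound
on the overlap. -/
theorem rtr_conj_mul_le_fidelity {ρ S G K L : Matrix X X ℂ} {κ : ℝ} (hκ : 0 ≤ κ) (hS : S.PosDef)
    (hG : G * Gᴴ ≤ κ • S) (hK : K * Kᴴ ≤ 1) (hL : L * Lᴴ ≤ 1) :
    rtr ((G * K)ᴴ * (CFC.sqrt ρ * L)) ≤ Real.sqrt κ * fidelity ρ S := by
  set s := CFC.sqrt S with hs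
  have hu : IsUnit s.det := isUnit_sqrt_det hS
  have hss : s * s = S := sqrt_mul_sqrt (nonneg_iff_posSemidef.2 hS.posSemidef)
  have hsH : sᴴ = s := conjTranspose_sqrt S
  have hsi : s⁻¹ᴴ = s⁻¹ := conjTranspose_inv_sqrt S
  set J := s⁻¹ * G with hJ
  have hsJ : s * J = G := by rw [hJ, mul_nonsing_inv_cancel_left _ _ hu]
  have hJJ : J * Jᴴ ≤ κ • (1 : Matrix X X ℂ) := by
    have := conj_mono hG s⁻¹
    rw [hsi, Matrix.mul_smul, Matrix.smul_mul, ← hss, nonsing_inv_mul_cancel_left _ _ hu,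
      mul_nonsing_inv _ hu] at this
    rwa [hJ, conjTranspose_mul, hsi, Matrix.mul_assoc, ← Matrix.mul_assoc G, ← Matrix.mul_assoc]
  have hKK : (K * Lᴴ)ᴴ * (K * Lᴴ) ≤ 1 := by
    have h1 : Kᴴ * K ≤ 1 := by
      simpa using conjTranspose_mul_le_of_mul_conjTranspose_le (K := K) one_pos (by simpa using hK)
    have h2 := conj_mono h1 L
    rw [Matrix.mul_one] at h2
    refine le_trans (le_of_eq ?_) (h2.trans hL)
    simp only [conjTranspose_mul, conjTranspose_conjTranspose, Matrix.mul_assoc]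
  have hB : (J * (K * Lᴴ))ᴴ * (J * (K * Lᴴ)) ≤ κ • (1 : Matrix X X ℂ) := by
    have h3 : Jᴴ * J ≤ κ • (1 : Matrix X X ℂ) := by
      rcases hκ.eq_or_lt with h0 | h0
      · rw [← h0, zero_smul] at hJJ ⊢
        have h4 : J * Jᴴ = 0 := le_antisymm hJJ (mul_conjTranspose_nonneg J)
        rw [self_mul_conjTranspose_eq_zero.1 h4]
        simp
      · exact conjTranspose_mul_le_of_mul_conjTranspose_le h0 hJJ
    have h4 := conj_mono' h3 (K * Lᴴ)
    rw [Matrix.mul_smul, Matrix.smul_mul, Matrix.mul_one] at h4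
    have h5 : κ • ((K * Lᴴ)ᴴ * (K * Lᴴ)) ≤ κ • (1 : Matrix X X ℂ) := by
      rw [← sub_nonneg, ← smul_sub, nonneg_iff_posSemidef]
      exact (nonneg_iff_posSemidef.1 (sub_nonneg.2 hKK)).smul hκ
    refine le_trans (le_of_eq ?_) (h4.trans h5)
    rw [conjTranspose_mul J]
    simp only [Matrix.mul_assoc]
  refine le_trans (le_of_eq ?_) (rtr_mul_le_traceNorm hκ hB)
  rw [← rtr_conjTranspose, conjTranspose_mul, conjTranspose_conjTranspose, conjTranspose_mul,
    conjTranspose_sqrt, ← hsJ, rtr_mul_comm]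
  rw [show s * J * K * (Lᴴ * CFC.sqrt ρ) = s * (J * (K * Lᴴ) * CFC.sqrt ρ) by
    simp only [Matrix.mul_assoc], rtr_mul_comm, Matrix.mul_assoc]

/-- A projector separating `R` from `T` at threshold `ν`, in terms of their fidelity. -/
theorem exists_projector_fidelity {R T : Matrix X X ℂ} (hR : 0 ≤ R) (hT : T.PosDef) {ν : ℝ}
    (hν : 0 ≤ ν) :
    ∃ Q : Matrix X X ℂ, Qᴴ = Q ∧ Q * Q = Q ∧ ν * rtr (Q * T) ≤ fidelity R T ∧
      rtr ((1 - Q) * R) ≤ ν * fidelity R T := by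
  set s := CFC.sqrt T with hs
  have hu : IsUnit s.det := isUnit_sqrt_det hT
  have hss : s * s = T := sqrt_mul_sqrt (nonneg_iff_posSemidef.2 hT.posSemidef)
  have hsH : sᴴ = s := conjTranspose_sqrt T
  have hsi : s⁻¹ᴴ = s⁻¹ := conjTranspose_inv_sqrt T
  have hF : (CFC.sqrt R * s)ᴴ * (CFC.sqrt R * s) = s * R * s := by
    rw [conjTranspose_mul, hsH, conjTranspose_sqrt, Matrix.mul_assoc,
      ← Matrix.mul_assoc (CFC.sqrt R), sqrt_mul_sqrt hR, Matrix.mul_assoc]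
  set W := CFC.sqrt (s * R * s) with hW
  have hfid : fidelity R T = rtr W := by rw [fidelity, traceNorm, ← hs, hF]
  have hW0 : 0 ≤ W := CFC.sqrt_nonneg _
  have hWW : W * W = s * R * s := sqrt_mul_sqrt (by rw [← hF]; exact conjTranspose_mul_nonneg _)
  -- The geometric mean of T⁻¹ and R: it solves Z T Z = R, and tr(ZT) = F(R,T). Q is its spectral
  -- projector for [ν, ∞). The two estimates come from νQ ≤ Z and Z(1 - Q)Z ≤ νZ, both traced
  -- against T.
  set Z := s⁻¹ * W * s⁻¹ with hZ
  have hZ0 : 0 ≤ Z := by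
    have := conj_mono hW0 s⁻¹
    rwa [Matrix.mul_zero, Matrix.zero_mul, hsi] at this
  have hsZ : s * Z * s = W := by
    rw [hZ, Matrix.mul_assoc s⁻¹, mul_nonsing_inv_cancel_left _ _ hu,
      nonsing_inv_mul_cancel_right _ _ hu]
  have hZTZ : Z * T * Z = R := by
    have h1 : Z * s = s⁻¹ * W := by rw [hZ, nonsing_inv_mul_cancel_right _ _ hu]
    have h2 : s * Z = W * s⁻¹ := by
      rw [hZ, Matrix.mul_assoc s⁻¹, mul_nonsing_inv_cancel_left _ _ hu]
    rw [← hss, ← Matrix.mul_assoc Z, h1, Matrix.mul_assoc (s⁻¹ * W), h2, Matrix.mul_assoc,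
      ← Matrix.mul_assoc W, hWW, Matrix.mul_assoc (s * R), mul_nonsing_inv _ hu, Matrix.mul_one,
      nonsing_inv_mul_cancel_left _ _ hu]
  set q : ℝ → ℝ := fun x => if ν ≤ x then 1 else 0 with hq
  have hQQ : cfc q Z * cfc q Z = cfc q Z := by
    rw [cfc_mul_cfc]
    congr 1
    ext x
    simp [hq]
  have h1Q : 1 - cfc q Z = cfc (fun x => 1 - q x) Z := by
    rw [cfc_sub _ _ _ (continuousOn_spectrum _ _) (continuousOn_spectrum _ _)]
    congr 1
    exact (cfc_one ℝ Z hZ0.isSelfAdjoint).symm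
  refine ⟨cfc q Z, conjTranspose_cfc _ _, hQQ, ?_, ?_⟩
  · have h1 : ν • cfc q Z ≤ Z := by
      rw [← cfc_smul _ _ _ (continuousOn_spectrum _ _)]
      conv_rhs => rw [← cfc_id_eq hZ0]
      refine cfc_le_cfc (fun x hx => ?_) hZ0
      by_cases h : ν ≤ x <;> simp [hq, h, hx]
    have h2 := rtr_mono (conj_mono h1 s)
    rw [hsH, hsZ, Matrix.mul_smul, Matrix.smul_mul, rtr_smul] at h2
    rwa [hfid, ← hss, ← Matrix.mul_assoc, rtr_mul_comm, ← Matrix.mul_assoc]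
  · have h1 : Z * (1 - cfc q Z) * Z ≤ ν • Z := by
      have e : Z * (1 - cfc q Z) * Z = cfc (fun x : ℝ => x * (1 - q x) * x) Z := by
        rw [← cfc_mul_cfc, ← cfc_mul_cfc, cfc_id_eq hZ0, h1Q]
      have e2 : ν • Z = cfc (fun x : ℝ => ν • x) Z := by
        rw [cfc_smul _ _ _ (continuousOn_spectrum _ _), cfc_id_eq hZ0]
      rw [e, e2]
      refine cfc_le_cfc (fun x hx => ?_) hZ0
      by_cases h : ν ≤ x
      · simpa [hq, h] using mul_nonneg hν hx
      · simp only [hq, h, if_false, smul_eq_mul]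
        nlinarith
    have h2 := rtr_mono (conj_mono h1 s)
    rw [hsH, Matrix.mul_smul, Matrix.smul_mul, rtr_smul, hsZ] at h2
    rw [hfid]
    refine le_trans (le_of_eq ?_) h2
    conv_lhs => rw [← hZTZ, ← hss]
    rw [show (1 - cfc q Z) * (Z * (s * s) * Z) = (1 - cfc q Z) * Z * s * (s * Z) by
      simp only [Matrix.mul_assoc], rtr_mul_comm]
    simp only [Matrix.mul_assoc]

theorem fidelity_nonneg (R S : Matrix X X ℂ) : 0 ≤ fidelity R S := traceNorm_nonneg _

theorem fidelity_le {R S : Matrix X X ℂ} (hR : 0 ≤ R) (hS : 0 ≤ S) :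
    fidelity R S ≤ Real.sqrt (rtr R) * Real.sqrt (rtr S) := by
  obtain ⟨K, hK, h⟩ := exists_contraction_rtr_eq_fidelity R S
  rw [← h]
  refine (rtr_conjTranspose_mul_le _ _).trans ?_
  rw [conjTranspose_sqrt, sqrt_mul_sqrt hS, rtr_mul_comm]
  have := rtr_mono (sqrt_mul_contraction_le hR hK)
  gcongr

theorem fidelity_self {R : Matrix X X ℂ} (hR : 0 ≤ R) : fidelity R R = rtr R := by
  rw [fidelity, traceNorm, sqrt_mul_sqrt hR, (nonneg_iff_posSemidef.1 hR).1, CFC.sqrt_mul_self R hR]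

end Fidelity

/-! ### Superadditivity of arcsine, and triangle inequalities with a projector. -/

section Angles

/-- The addition formula gives sin(a + b) ≤ x + y. The sum a + b stays below π/2, since otherwise
cos b < sin a and 1 < x² + y² ≤ (x + y)². -/
theorem arcsin_add_arcsin_le {x y : ℝ} (hx : 0 ≤ x) (hy : 0 ≤ y) (hxy : x + y ≤ 1) :
    Real.arcsin x + Real.arcsin y ≤ Real.arcsin (x + y) := by
  set a := Real.arcsin x with ha
  set b := Real.arcsin y with hb
  have hxa : Real.sin a = x := Real.sin_arcsin (by linarith) (by linarith)
  have hyb : Real.sin b = y := Real.sin_arcsin (by linarith) (by linarith)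
  have ha0 : 0 ≤ a := Real.arcsin_nonneg.2 hx
  have hb0 : 0 ≤ b := Real.arcsin_nonneg.2 hy
  have ha1 : a ≤ Real.pi / 2 := Real.arcsin_le_pi_div_two x
  have hb1 : b ≤ Real.pi / 2 := Real.arcsin_le_pi_div_two y
  have hcb : 0 ≤ Real.cos b := Real.cos_nonneg_of_mem_Icc ⟨by linarith, hb1⟩
  have hle : a + b ≤ Real.pi / 2 := by
    by_contra! hcon
    have h1 : Real.cos b < Real.sin a := by
      rw [← Real.sin_pi_div_two_sub]
      exact Real.sin_lt_sin_of_lt_of_le_pi_div_two (by linarith) ha1 (by linarith)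
    nlinarith [Real.sin_sq_add_cos_sq b]
  rw [Real.le_arcsin_iff_sin_le' ⟨by linarith [Real.pi_pos], hle⟩]
  rw [Real.sin_add, hxa, hyb]
  nlinarith [Real.cos_le_one a, Real.cos_le_one b]

theorem arccos_le_arcsin {x y : ℝ} (hy : 0 ≤ y) (h : Real.sqrt (1 - y ^ 2) ≤ x) :
    Real.arccos x ≤ Real.arcsin y := by
  have := Real.arccos_le_arccos h
  rwa [← Real.arcsin_eq_arccos hy] at this

theorem one_sub_sqrt_pos {ε : ℝ} (hε : 0 < ε) : 0 < 1 - Real.sqrt (1 - ε ^ 2) := by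
  rw [sub_pos, Real.sqrt_lt' one_pos]
  nlinarith

theorem arccos_le_arcsin_two_mul_sqrt {t : ℝ} (h0 : 0 ≤ t) (h1 : t ≤ 1) :
    Real.arccos t ≤ Real.arcsin (2 * Real.sqrt (1 - t)) := by
  refine arccos_le_arcsin (by positivity) (Real.sqrt_le_iff.2 ⟨h0, ?_⟩)
  rw [mul_pow, Real.sq_sqrt (by linarith)]
  nlinarith

theorem sqrt_mul_sqrt_one_sub {a b : ℝ} (ha : a ≤ 1) :
    Real.sqrt (1 - a) * Real.sqrt (1 - b) = Real.sqrt ((1 - a) * (1 - b)) :=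
  (Real.sqrt_mul (by linarith) _).symm

variable {X : Type*} [Fintype X]

theorem re_inner_vec_self {N : Matrix X X ℂ} {t : ℝ} (hN : rtr (Nᴴ * N) ≤ t) (ht : t ≤ 1) :
    (inner ℂ (vec N 0 ![Real.sqrt (1 - t), 0, Real.sqrt (t - rtr (Nᴴ * N)), 0])
      (vec N 0 ![Real.sqrt (1 - t), 0, Real.sqrt (t - rtr (Nᴴ * N)), 0])).re = 1 := by
  rw [re_inner_vec]
  simp [Fin.sum_univ_four, rtr_zero, Real.mul_self_sqrt (sub_nonneg.2 hN),
    Real.mul_self_sqrt (sub_nonneg.2 ht)]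

variable {Q : Matrix X X ℂ}

theorem rtr_projector_mul (hQ : Qᴴ = Q) (hQQ : Q * Q = Q) (M N : Matrix X X ℂ) :
    rtr ((Q * M)ᴴ * (Q * N)) = rtr (Mᴴ * (Q * N)) := by
  rw [conjTranspose_mul, hQ, Matrix.mul_assoc, ← Matrix.mul_assoc Q, hQQ]

variable [DecidableEq X]

theorem rtr_projector_compl_mul (hQ : Qᴴ = Q) (hQQ : Q * Q = Q) (M N : Matrix X X ℂ) :
    rtr (((1 - Q) * M)ᴴ * ((1 - Q) * N)) = rtr (Mᴴ * N) - rtr (Mᴴ * (Q * N)) := by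
  rw [rtr_projector_mul (Q := 1 - Q) (by simp [hQ])
    (by simp [Matrix.sub_mul, Matrix.mul_sub, hQQ]), Matrix.sub_mul, Matrix.one_mul,
    Matrix.mul_sub, rtr_sub]

/-- The path is R, N, (QN, (1 - Q)N), (QR, (1 - Q)R). Splitting by Q is isometric, so the outer two
steps have the same angle. Among the real coordinates, slot 0 carries the missing trace and so
produces the generalized fidelity; slot 2 pads N to unit length. -/
theorem arccos_projector_le (hQ : Qᴴ = Q) (hQQ : Q * Q = Q) {R N : Matrix X X ℂ} {t t' : ℝ}
    (hR : rtr (Rᴴ * R) = t) (ht : t ≤ 1) (hN : rtr (Nᴴ * N) ≤ t') (ht' : t' ≤ 1) :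
    Real.arccos (rtr (Rᴴ * (Q * R)) + (1 - t)) ≤
      2 * Real.arccos (rtr (Nᴴ * R) + Real.sqrt ((1 - t') * (1 - t))) +
        Real.arccos (rtr (Nᴴ * (Q * N)) + (1 - rtr (Nᴴ * N))) := by
  set d := Real.sqrt (t' - rtr (Nᴴ * N)) with hd
  have hdd : d * d = t' - rtr (Nᴴ * N) := Real.mul_self_sqrt (sub_nonneg.2 hN)
  have h1t : Real.sqrt (1 - t) * Real.sqrt (1 - t) = 1 - t := Real.mul_self_sqrt (by linarith)
  have h1t' : Real.sqrt (1 - t') * Real.sqrt (1 - t') = 1 - t' := Real.mul_self_sqrt (by linarith)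
  set u := vec R 0 ![Real.sqrt (1 - t), 0, 0, 0] with hu
  set v := vec N 0 ![Real.sqrt (1 - t'), 0, d, 0] with hv
  set w := vec (Q * N) ((1 - Q) * N) ![Real.sqrt (1 - t'), 0, d, 0] with hw
  set z := vec (Q * R) ((1 - Q) * R) ![Real.sqrt (1 - t), 0, 0, 0] with hz
  have huu : (inner ℂ u u).re = 1 := by
    rw [hu, re_inner_vec]
    simp [Fin.sum_univ_four, rtr_zero, hR, h1t]
  have hvv : (inner ℂ v v).re = 1 := re_inner_vec_self hN ht'
  have hww : (inner ℂ w w).re = 1 := by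
    rw [hw, re_inner_vec, rtr_projector_mul hQ hQQ, rtr_projector_compl_mul hQ hQQ]
    simp [Fin.sum_univ_four, hdd, h1t']
  have hzz : (inner ℂ z z).re = 1 := by
    rw [hz, re_inner_vec, rtr_projector_mul hQ hQQ, rtr_projector_compl_mul hQ hQQ]
    simp [Fin.sum_univ_four, hR, h1t]
  have huz : (inner ℂ u z).re = rtr (Rᴴ * (Q * R)) + (1 - t) := by
    rw [hu, hz, re_inner_vec]
    simp [Fin.sum_univ_four, rtr_zero, h1t]
  have huv : (inner ℂ u v).re = rtr (Nᴴ * R) + Real.sqrt ((1 - t') * (1 - t)) := by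
    rw [hu, hv, re_inner_vec, ← rtr_conjTranspose, ← sqrt_mul_sqrt_one_sub ht', mul_comm √(1 - t')]
    simp [Fin.sum_univ_four, rtr_zero]
  have hwz : (inner ℂ w z).re = rtr (Nᴴ * R) + Real.sqrt ((1 - t') * (1 - t)) := by
    rw [hw, hz, re_inner_vec, rtr_projector_mul hQ hQQ, rtr_projector_compl_mul hQ hQQ,
      ← sqrt_mul_sqrt_one_sub ht']
    simp [Fin.sum_univ_four]
  have hvw : (inner ℂ v w).re = rtr (Nᴴ * (Q * N)) + (1 - rtr (Nᴴ * N)) := by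
    rw [hv, hw, re_inner_vec]
    simp [Fin.sum_univ_four, rtr_zero, hdd, h1t']
  have h1 := arccos_triangle huu hvv hzz
  have h2 := arccos_triangle hvv hww hzz
  rw [huz, huv] at h1
  rw [hvw, hwz] at h2
  linarith

/-- The real coordinates of v and w occupy disjoint slots, so their inner product is exactly the
wanted overlap, with no trace-defect term. The price is moving the defect of R from slot 0 to slot 1
(from u to u'), which costs `arccos t`. -/
theorem arccos_overlap_le (hQ : Qᴴ = Q) (hQQ : Q * Q = Q) {R N M : Matrix X X ℂ} {t t' t'' : ℝ}
    (hR : rtr (Rᴴ * R) = t) (ht : t ≤ 1) (hN : rtr (Nᴴ * N) ≤ t') (ht' : t' ≤ 1)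
    (hM : rtr (Mᴴ * M) ≤ t'') (ht'' : t'' ≤ 1) :
    Real.arccos (rtr (Nᴴ * (Q * M))) ≤
      Real.arccos (rtr (Nᴴ * R) + Real.sqrt ((1 - t') * (1 - t))) + Real.arccos t +
        Real.arccos (rtr (Rᴴ * (Q * R)) + (1 - t)) +
        Real.arccos (rtr (Mᴴ * R) + Real.sqrt ((1 - t'') * (1 - t))) := by
  set d := Real.sqrt (t' - rtr (Nᴴ * N)) with hd
  set e := Real.sqrt (t'' - rtr (Mᴴ * M)) with he
  have hee : e * e = t'' - rtr (Mᴴ * M) := Real.mul_self_sqrt (sub_nonneg.2 hM)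
  have h1t : Real.sqrt (1 - t) * Real.sqrt (1 - t) = 1 - t := Real.mul_self_sqrt (by linarith)
  have h1t'' : Real.sqrt (1 - t'') * Real.sqrt (1 - t'') = 1 - t'' :=
    Real.mul_self_sqrt (by linarith)
  set v := vec N 0 ![Real.sqrt (1 - t'), 0, d, 0] with hv
  set u := vec R 0 ![Real.sqrt (1 - t), 0, 0, 0] with hu
  set u' := vec R 0 ![0, Real.sqrt (1 - t), 0, 0] with hu'
  set z := vec (Q * R) ((1 - Q) * R) ![0, Real.sqrt (1 - t), 0, 0] with hz
  set w := vec (Q * M) ((1 - Q) * M) ![0, Real.sqrt (1 - t''), 0, e] with hw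
  have hvv : (inner ℂ v v).re = 1 := re_inner_vec_self hN ht'
  have huu : (inner ℂ u u).re = 1 := by
    rw [hu, re_inner_vec]
    simp [Fin.sum_univ_four, rtr_zero, hR, h1t]
  have huu' : (inner ℂ u' u').re = 1 := by
    rw [hu', re_inner_vec]
    simp [Fin.sum_univ_four, rtr_zero, hR, h1t]
  have hzz : (inner ℂ z z).re = 1 := by
    rw [hz, re_inner_vec, rtr_projector_mul hQ hQQ, rtr_projector_compl_mul hQ hQQ]
    simp [Fin.sum_univ_four, hR, h1t]
  have hww : (inner ℂ w w).re = 1 := by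
    rw [hw, re_inner_vec, rtr_projector_mul hQ hQQ, rtr_projector_compl_mul hQ hQQ]
    simp [Fin.sum_univ_four, hee, h1t'']
  have hvw : (inner ℂ v w).re = rtr (Nᴴ * (Q * M)) := by
    rw [hv, hw, re_inner_vec]
    simp [Fin.sum_univ_four, rtr_zero]
  have hvu : (inner ℂ v u).re = rtr (Nᴴ * R) + Real.sqrt ((1 - t') * (1 - t)) := by
    rw [hv, hu, re_inner_vec, ← sqrt_mul_sqrt_one_sub ht']
    simp [Fin.sum_univ_four, rtr_zero]
  have huu'' : (inner ℂ u u').re = t := by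
    rw [hu, hu', re_inner_vec]
    simp [Fin.sum_univ_four, rtr_zero, hR]
  have huz : (inner ℂ u' z).re = rtr (Rᴴ * (Q * R)) + (1 - t) := by
    rw [hu', hz, re_inner_vec]
    simp [Fin.sum_univ_four, rtr_zero, h1t]
  have hzw : (inner ℂ z w).re = rtr (Mᴴ * R) + Real.sqrt ((1 - t'') * (1 - t)) := by
    rw [hz, hw, re_inner_vec, rtr_projector_mul hQ hQQ, rtr_projector_compl_mul hQ hQQ,
      ← rtr_conjTranspose (Mᴴ * R), ← sqrt_mul_sqrt_one_sub ht'', mul_comm √(1 - t'')]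
    simp [Fin.sum_univ_four]
  have h1 := arccos_triangle hvv huu hww
  have h2 := arccos_triangle huu huu' hww
  have h3 := arccos_triangle huu' hzz hww
  rw [hvw, hvu] at h1
  rw [huu''] at h2
  rw [huz, hzw] at h3
  linarith

end Angles

/-! ### The two-sided estimate of the overlap. -/

section Overlap

variable {X Y : Type*} [Fintype X] [DecidableEq X] [Fintype Y] [DecidableEq Y]

theorem SubNormalized.nonneg {X : Type*} [Fintype X] {R : Matrix X X ℂ} (h : R ∈ SubNormalized X) : 0 ≤ R :=
  nonneg_iff_posSemidef.2 h.1

theorem genFidelity_nonneg (R S : Matrix X X ℂ) : 0 ≤ genFidelity R S :=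
  add_nonneg (fidelity_nonneg _ _) (Real.sqrt_nonneg _)

theorem arccos_genFidelity_le {R S : Matrix X X ℂ} {ε : ℝ} (h0 : 0 ≤ ε)
    (h : purifiedDist S R ≤ ε) : Real.arccos (genFidelity S R) ≤ Real.arcsin ε := by
  refine arccos_le_arcsin h0 (Real.sqrt_le_iff.2 ⟨genFidelity_nonneg _ _, ?_⟩)
  have := (Real.sqrt_le_iff.1 h).2
  linarith

theorem sqrt_one_sub_sq_le {x y : ℝ} (h : Real.arccos x ≤ Real.arcsin y) :
    Real.sqrt (1 - y ^ 2) ≤ x := by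
  rw [← Real.cos_arcsin]
  rcases le_total x (-1) with h1 | h1
  · rw [Real.arccos_of_le_neg_one h1] at h
    linarith [Real.arcsin_le_pi_div_two y, Real.pi_pos]
  · rcases le_total 1 x with h2 | h2
    · exact (Real.cos_le_one _).trans h2
    · rw [← Real.cos_arccos h1 h2]
      exact Real.cos_le_cos_of_nonneg_of_le_pi (Real.arccos_nonneg x)
        (by linarith [Real.arcsin_le_pi_div_two y, Real.pi_pos]) h

theorem rtr_one_kronecker_mul {Y : Type*} [Fintype Y] (Q : Matrix Y Y ℂ) (ρ : Matrix (X × Y) (X × Y) ℂ) :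
    rtr (((1 : Matrix X X ℂ) ⊗ₖ Q) * ρ) = rtr (Q * trFst ρ) := by
  simp only [rtr, trace, diag, mul_apply, trFst, of_apply, kroneckerMap_apply,
    Fintype.sum_prod_type, one_apply, Finset.mul_sum]
  congr 1
  rw [Finset.sum_comm]
  refine Finset.sum_congr rfl fun y _ => ?_
  rw [Finset.sum_comm]
  simp
  rw [Finset.sum_comm]

theorem rtr_trFst (ρ : Matrix (X × Y) (X × Y) ℂ) : rtr (trFst ρ) = rtr ρ := by
  have := rtr_one_kronecker_mul (1 : Matrix Y Y ℂ) ρ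
  simpa using this.symm

theorem trFst_eq_sum {X Y : Type*} [Fintype X] (ρ : Matrix (X × Y) (X × Y) ℂ) :
    trFst ρ = ∑ x, ρ.submatrix (Prod.mk x) (Prod.mk x) := by
  ext y y'
  simp [trFst, Matrix.sum_apply]

theorem trFst_nonneg {X Y : Type*} [Fintype X] {ρ : Matrix (X × Y) (X × Y) ℂ} (h : 0 ≤ ρ) : 0 ≤ trFst ρ := by
  rw [trFst_eq_sum]
  exact Finset.sum_nonneg fun x _ =>
    nonneg_iff_posSemidef.2 ((nonneg_iff_posSemidef.1 h).submatrix _)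

theorem one_kronecker_mono {X Y : Type*} [Fintype X] [DecidableEq X] [Fintype Y] {M N : Matrix Y Y ℂ} (h : M ≤ N) :
    (1 : Matrix X X ℂ) ⊗ₖ M ≤ (1 : Matrix X X ℂ) ⊗ₖ N := by
  have e : (1 : Matrix X X ℂ) ⊗ₖ N - (1 : Matrix X X ℂ) ⊗ₖ M = (1 : Matrix X X ℂ) ⊗ₖ (N - M) := by
    ext
    simp [mul_sub]
  rw [← sub_nonneg, nonneg_iff_posSemidef, e]
  exact PosSemidef.one.kronecker (nonneg_iff_posSemidef.1 (sub_nonneg.2 h))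

theorem smul_mono {X : Type*} {M N : Matrix X X ℂ} (h : M ≤ N) {c : ℝ} (hc : 0 ≤ c) : c • M ≤ c • N := by
  rw [← sub_nonneg, ← smul_sub, nonneg_iff_posSemidef]
  exact (nonneg_iff_posSemidef.1 (sub_nonneg.2 h)).smul hc

theorem rtr_one : rtr (1 : Matrix X X ℂ) = Fintype.card X := by simp [rtr]

/-- A projector `Q` such that `1 - Q` has expectation at most `p` under `R`. -/
theorem exists_projector_rtr_le {R T : Matrix X X ℂ} (hR : 0 ≤ R) (hT : T.PosDef) {p : ℝ}
    (hp : 0 < p) :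
    ∃ Q : Matrix X X ℂ, Qᴴ = Q ∧ Q * Q = Q ∧ rtr (Q * T) ≤ fidelity R T ^ 2 / p ∧
      rtr ((1 - Q) * R) ≤ p := by
  rcases (fidelity_nonneg R T).eq_or_lt with h | h
  · obtain ⟨Q, h1, h2, h3, h4⟩ := exists_projector_fidelity hR hT zero_le_one
    rw [← h] at h3 h4
    exact ⟨Q, h1, h2, by rw [← h]; simpa using h3, by linarith⟩
  -- The threshold ν = p / F(R,T) makes the second bound exactly p.
  · obtain ⟨Q, h1, h2, h3, h4⟩ := exists_projector_fidelity hR hT (div_pos hp h).le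
    refine ⟨Q, h1, h2, ?_, by rwa [div_mul_cancel₀ _ h.ne'] at h4⟩
    rw [le_div_iff₀ hp]
    rw [div_mul_eq_mul_div, div_le_iff₀ h] at h3
    linarith

theorem le_rtr_projector_add {Q : Matrix X X ℂ} (hQ : Qᴴ = Q) (hQQ : Q * Q = Q)
    {N R : Matrix X X ℂ} (hN : N * Nᴴ ≤ R) :
    1 - rtr ((1 - Q) * R) ≤ rtr (Nᴴ * (Q * N)) + (1 - rtr (Nᴴ * N)) := by
  have hP : (1 - Q)ᴴ = 1 - Q := by simp [hQ]
  have hPP : (1 - Q) * (1 - Q) = 1 - Q := by simp [Matrix.sub_mul, Matrix.mul_sub, hQQ]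
  have h := rtr_mono (conj_mono hN (1 - Q))
  have e : ∀ M : Matrix X X ℂ, rtr ((1 - Q) * M * (1 - Q)) = rtr ((1 - Q) * M) := fun M => by
    rw [rtr_mul_comm, ← Matrix.mul_assoc, hPP]
  rw [hP, e, e, ← Matrix.mul_assoc, rtr_mul_comm, Matrix.sub_mul, Matrix.one_mul, Matrix.mul_sub,
    rtr_sub] at h
  linarith

/-- Here X is A and Y is BC. T is invertible so that the separating projector exists, and `δ` makes
the normalised compression invertible too. -/
theorem one_sub_sq_le_mul {ρ ρ₁ ρ₃ : Matrix (X × Y) (X × Y) ℂ} {ρ₂ T : Matrix Y Y ℂ}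
    {ε ε₁ ε₂ ε₃ k a b δ : ℝ} (hε : 0 < ε) (hε₁ : 0 ≤ ε₁) (hε₂ : 0 ≤ ε₂) (hε₃ : 0 ≤ ε₃)
    (hρ : ρ ∈ SubNormalized (X × Y)) (hρ₁ : ρ₁ ∈ closeStates ε₁ ρ)
    (hρ₂ : ρ₂ ∈ closeStates ε₂ (trFst ρ)) (hρ₃ : ρ₃ ∈ closeStates ε₃ ρ)
    (hsum : ε + ε₁ + 2 * ε₂ + ε₃ + 2 * Real.sqrt (1 - rtr ρ) ≤ 1)
    (hT : T.PosDef) (hk : 0 ≤ k) (hρT : ρ₁ ≤ k • ((1 : Matrix X X ℂ) ⊗ₖ T))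
    (ha : ∀ τ ∈ SubNormalized Y, fidelity ρ₃ ((1 : Matrix X X ℂ) ⊗ₖ τ) ^ 2 ≤ a)
    (hb : fidelity ρ₂ T ^ 2 ≤ b) (hδ : 0 < δ) [Nonempty Y] :
    1 - (ε + ε₁ + 2 * ε₂ + ε₃ + 2 * Real.sqrt (1 - rtr ρ)) ^ 2 ≤
      k * (b / (1 - Real.sqrt (1 - ε ^ 2)) + δ * Fintype.card Y) * a := by
  have hst : 0 ≤ Real.sqrt (1 - rtr ρ) := Real.sqrt_nonneg _
  have hp : 0 < 1 - Real.sqrt (1 - ε ^ 2) := one_sub_sqrt_pos hε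
  obtain ⟨Q, hQ, hQQ, hQT, hQR⟩ :=
    exists_projector_rtr_le (SubNormalized.nonneg hρ₂.1) hT hp
  have hρ0 := SubNormalized.nonneg hρ
  have hρ₁0 := SubNormalized.nonneg hρ₁.1
  have hρ₂0 := SubNormalized.nonneg hρ₂.1
  have hρ₃0 := SubNormalized.nonneg hρ₃.1
  set P : Matrix (X × Y) (X × Y) ℂ := (1 : Matrix X X ℂ) ⊗ₖ Q with hPdef
  have hP : Pᴴ = P := by rw [hPdef, conjTranspose_kronecker, hQ, conjTranspose_one]
  have hPP : P * P = P := by rw [hPdef, ← mul_kronecker_mul, hQQ, Matrix.one_mul]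
  obtain ⟨K₁, hK₁, hF₁⟩ := exists_contraction_rtr_eq_fidelity ρ₁ ρ
  obtain ⟨K₂, hK₂, hF₂⟩ := exists_contraction_rtr_eq_fidelity ρ₂ (trFst ρ)
  obtain ⟨K₃, hK₃, hF₃⟩ := exists_contraction_rtr_eq_fidelity ρ₃ ρ
  have hN₁ := sqrt_mul_contraction_le hρ₁0 hK₁
  have hN₂ := sqrt_mul_contraction_le hρ₂0 hK₂
  have hN₃ := sqrt_mul_contraction_le hρ₃0 hK₃
  have hR : rtr ((CFC.sqrt ρ)ᴴ * CFC.sqrt ρ) = rtr ρ := by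
    rw [conjTranspose_sqrt, sqrt_mul_sqrt hρ0]
  have hR₂ : rtr ((CFC.sqrt (trFst ρ))ᴴ * CFC.sqrt (trFst ρ)) = rtr ρ := by
    rw [conjTranspose_sqrt, sqrt_mul_sqrt (trFst_nonneg hρ0), rtr_trFst]
  -- Q acts on Y only, so its weight on ρ is its weight on the reduced state; this brings in the
  -- smoothing of ρ₂.
  have hPQ : rtr ((CFC.sqrt ρ)ᴴ * (P * CFC.sqrt ρ)) =
      rtr ((CFC.sqrt (trFst ρ))ᴴ * (Q * CFC.sqrt (trFst ρ))) := by
    rw [rtr_mul_comm, rtr_mul_comm _ (Q * _), conjTranspose_sqrt, conjTranspose_sqrt,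
      Matrix.mul_assoc, Matrix.mul_assoc, sqrt_mul_sqrt hρ0, sqrt_mul_sqrt (trFst_nonneg hρ0),
      rtr_one_kronecker_mul]
  have hang := arccos_overlap_le hP hPP hR hρ.2
    ((rtr_mul_comm _ _).trans_le (rtr_mono hN₁)) hρ₁.1.2
    ((rtr_mul_comm _ _).trans_le (rtr_mono hN₃)) hρ₃.1.2
  have hang₂ := arccos_projector_le hQ hQQ hR₂ hρ.2
    ((rtr_mul_comm _ _).trans_le (rtr_mono hN₂)) hρ₂.1.2
  rw [hF₁, hF₃, hPQ] at hang
  rw [hF₂, ← rtr_trFst ρ] at hang₂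
  have h₁ := arccos_genFidelity_le hε₁ hρ₁.2
  have h₂ := arccos_genFidelity_le hε₂ hρ₂.2
  have h₃ := arccos_genFidelity_le hε₃ hρ₃.2
  rw [genFidelity] at h₁ h₂ h₃
  have h₄ := arccos_le_arcsin_two_mul_sqrt (rtr_nonneg hρ0) hρ.2
  have h₅ : Real.arccos (rtr ((CFC.sqrt ρ₂ * K₂)ᴴ * (Q * (CFC.sqrt ρ₂ * K₂))) +
      (1 - rtr ((CFC.sqrt ρ₂ * K₂)ᴴ * (CFC.sqrt ρ₂ * K₂)))) ≤ Real.arcsin ε :=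
    arccos_le_arcsin hε.le (by linarith [le_rtr_projector_add hQ hQQ hN₂])
  rw [rtr_trFst] at hang₂ h₂
  have s₁ := arcsin_add_arcsin_le hε.le hε₁ (by linarith)
  have s₂ := arcsin_add_arcsin_le (add_nonneg hε.le hε₁) hε₂ (by linarith)
  have s₃ := arcsin_add_arcsin_le (add_nonneg (add_nonneg hε.le hε₁) hε₂) hε₂ (by linarith)
  have s₄ := arcsin_add_arcsin_le (x := ε + ε₁ + ε₂ + ε₂) (by positivity) hε₃ (by linarith)
  have s₅ := arcsin_add_arcsin_le (x := ε + ε₁ + ε₂ + ε₂ + ε₃)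
    (y := 2 * Real.sqrt (1 - rtr ρ)) (by positivity) (by positivity) (by linarith)
  have hS : ε + ε₁ + ε₂ + ε₂ + ε₃ + 2 * Real.sqrt (1 - rtr ρ) =
    ε + ε₁ + 2 * ε₂ + ε₃ + 2 * Real.sqrt (1 - rtr ρ) := by ring
  rw [hS] at s₅
  have hlow := sqrt_one_sub_sq_le (hang.trans (by linarith : _ ≤ Real.arcsin
    (ε + ε₁ + 2 * ε₂ + ε₃ + 2 * Real.sqrt (1 - rtr ρ))))
  set W := Q * T * Q + δ • (1 : Matrix Y Y ℂ) with hW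
  have hQTQ : (Q * T * Q).PosSemidef := by
    have := hT.posSemidef.mul_mul_conjTranspose_same Q
    rwa [hQ] at this
  have hWpos : W.PosDef := PosDef.posSemidef_add hQTQ (PosDef.one.smul hδ)
  set s := rtr W with hs
  have hs_eq : s = rtr (Q * T) + δ * Fintype.card Y := by
    rw [hs, hW, rtr_add, rtr_smul, rtr_one, rtr_mul_comm, ← Matrix.mul_assoc, hQQ]
  have hs0 : 0 < s := by
    have : 0 ≤ rtr (Q * T * Q) := rtr_nonneg (nonneg_iff_posSemidef.2 hQTQ)
    rw [hs, hW, rtr_add, rtr_smul, rtr_one]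
    have : (0 : ℝ) < Fintype.card Y := by exact_mod_cast Fintype.card_pos
    positivity
  set τ := s⁻¹ • W with hτ
  have hτpos : τ.PosDef := hWpos.smul (inv_pos.2 hs0)
  have hτsub : τ ∈ SubNormalized Y :=
    ⟨hτpos.posSemidef, by rw [hτ, rtr_smul, ← hs, inv_mul_cancel₀ hs0.ne']⟩
  have hWτ : W = s • τ := by rw [hτ, smul_inv_smul₀ hs0.ne']
  have hG : (P * CFC.sqrt ρ₁) * (P * CFC.sqrt ρ₁)ᴴ ≤ (k * s) • ((1 : Matrix X X ℂ) ⊗ₖ τ) := by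
    have e : (P * CFC.sqrt ρ₁) * (P * CFC.sqrt ρ₁)ᴴ = P * ρ₁ * Pᴴ := by
      rw [conjTranspose_mul, conjTranspose_sqrt, Matrix.mul_assoc, ← Matrix.mul_assoc (CFC.sqrt ρ₁),
        sqrt_mul_sqrt hρ₁0, ← Matrix.mul_assoc]
    have e2 : P * (k • ((1 : Matrix X X ℂ) ⊗ₖ T)) * Pᴴ =
        k • ((1 : Matrix X X ℂ) ⊗ₖ (Q * T * Q)) := by
      rw [hP, Matrix.mul_smul, Matrix.smul_mul, hPdef, ← mul_kronecker_mul, ← mul_kronecker_mul,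
        Matrix.one_mul, Matrix.one_mul]
    rw [e, mul_smul, ← kronecker_smul, ← hWτ]
    refine (conj_mono hρT P).trans (e2.trans_le (smul_mono (one_kronecker_mono ?_) hk))
    rw [hW, le_add_iff_nonneg_right, nonneg_iff_posSemidef]
    exact (PosDef.one.smul hδ).posSemidef
  have hup := rtr_conj_mul_le_fidelity (ρ := ρ₃) (mul_nonneg hk hs0.le) (PosDef.one.kronecker hτpos)
    hG hK₁ hK₃
  have e3 : (P * CFC.sqrt ρ₁ * K₁)ᴴ * (CFC.sqrt ρ₃ * K₃) =
      (CFC.sqrt ρ₁ * K₁)ᴴ * (P * (CFC.sqrt ρ₃ * K₃)) := by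
    rw [Matrix.mul_assoc P, conjTranspose_mul P, hP, Matrix.mul_assoc]
  rw [e3] at hup
  have hfin := hlow.trans hup
  have hfa := ha τ hτsub
  have ha0 : 0 ≤ a := (sq_nonneg _).trans hfa
  have hsb : s ≤ b / (1 - Real.sqrt (1 - ε ^ 2)) + δ * Fintype.card Y := by
    rw [hs_eq]
    have : fidelity ρ₂ T ^ 2 / (1 - Real.sqrt (1 - ε ^ 2)) ≤ b / (1 - Real.sqrt (1 - ε ^ 2)) := by
      gcongr
    linarith
  have hsq := (Real.sqrt_le_iff.1 hfin).2
  rw [mul_pow, Real.sq_sqrt (mul_nonneg hk hs0.le)] at hsq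
  calc _ ≤ k * s * fidelity ρ₃ ((1 : Matrix X X ℂ) ⊗ₖ τ) ^ 2 := hsq
    _ ≤ _ := mul_le_mul (mul_le_mul_of_nonneg_left hsb hk) hfa (sq_nonneg _)
      (mul_nonneg hk (hs0.le.trans hsb))

end Overlap

/-! ### Invariance under relabelling of systems, and membership in smoothing balls. -/

section Reindex

variable {X Y : Type*} [Fintype X] [DecidableEq X] [Fintype Y] [DecidableEq Y]

theorem rtr_submatrix {X Y : Type*} [Fintype X] [Fintype Y] (e : Y ≃ X) (R : Matrix X X ℂ) : rtr (R.submatrix e e) = rtr R := by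
  simp only [rtr, trace, diag, submatrix_apply]
  rw [e.sum_comp fun x => R x x]

theorem submatrix_nonneg {X Y : Type*} {R : Matrix X X ℂ} (hR : 0 ≤ R) (e : Y → X) : 0 ≤ R.submatrix e e :=
  nonneg_iff_posSemidef.2 ((nonneg_iff_posSemidef.1 hR).submatrix e)

theorem sqrt_submatrix (e : Y ≃ X) {R : Matrix X X ℂ} (hR : 0 ≤ R) :
    CFC.sqrt (R.submatrix e e) = (CFC.sqrt R).submatrix e e := by
  have h0 : 0 ≤ (CFC.sqrt R).submatrix e e := submatrix_nonneg (R := CFC.sqrt R) (CFC.sqrt_nonneg R) e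
  refine CFC.sqrt_unique ?_ h0
  rw [submatrix_mul_equiv, sqrt_mul_sqrt hR]

theorem fidelity_submatrix (e : Y ≃ X) {R S : Matrix X X ℂ} (hR : 0 ≤ R) (hS : 0 ≤ S) :
    fidelity (R.submatrix e e) (S.submatrix e e) = fidelity R S := by
  rw [fidelity, fidelity, traceNorm, traceNorm, sqrt_submatrix e hR, sqrt_submatrix e hS,
    submatrix_mul_equiv, conjTranspose_submatrix, submatrix_mul_equiv,
    sqrt_submatrix e (conjTranspose_mul_nonneg _), rtr_submatrix]

theorem submatrix_mem_subNormalized {X Y : Type*} [Fintype X] [Fintype Y] (e : Y ≃ X) {R : Matrix X X ℂ} (hR : R ∈ SubNormalized X) :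
    R.submatrix e e ∈ SubNormalized Y :=
  ⟨hR.1.submatrix e, by rw [rtr_submatrix]; exact hR.2⟩

theorem submatrix_mem_closeStates (e : Y ≃ X) {R S : Matrix X X ℂ} {ε : ℝ} (hR : 0 ≤ R)
    (hS : S ∈ closeStates ε R) : S.submatrix e e ∈ closeStates ε (R.submatrix e e) := by
  refine ⟨submatrix_mem_subNormalized e hS.1, ?_⟩
  rw [purifiedDist, genFidelity, fidelity_submatrix e (SubNormalized.nonneg hS.1) hR,
    rtr_submatrix, rtr_submatrix]
  exact hS.2

theorem self_mem_closeStates {R : Matrix X X ℂ} {ε : ℝ} (hε : 0 ≤ ε) (hR : R ∈ SubNormalized X) :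
    R ∈ closeStates ε R := by
  refine ⟨hR, ?_⟩
  rw [purifiedDist, genFidelity, fidelity_self (SubNormalized.nonneg hR),
    Real.sqrt_mul_self (sub_nonneg.2 hR.2)]
  simpa using hε

theorem trFst_mem_subNormalized {ρ : Matrix (X × Y) (X × Y) ℂ} (hρ : ρ ∈ SubNormalized (X × Y)) :
    trFst ρ ∈ SubNormalized Y :=
  ⟨nonneg_iff_posSemidef.1 (trFst_nonneg (SubNormalized.nonneg hρ)), by rw [rtr_trFst]; exact hρ.2⟩

theorem rtr_one_kronecker {Y : Type*} [Fintype Y] (τ : Matrix Y Y ℂ) :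
    rtr ((1 : Matrix X X ℂ) ⊗ₖ τ) = Fintype.card X * rtr τ := by
  simp [rtr, trace_kronecker]

end Reindex

/-! ### The estimate for ABC, with invertibility removed by a limit. -/

section Tripartite

variable {A B C : Type*} [Fintype A] [DecidableEq A] [Fintype B] [DecidableEq B]
  [Fintype C] [DecidableEq C]

theorem exists_posDef_subNormalized_le [Nonempty C] {σ : Matrix C C ℂ} (hσ : σ ∈ SubNormalized C)
    {η : ℝ} (h0 : 0 < η) (h1 : η < 1) :
    ∃ ω ∈ SubNormalized C, ω.PosDef ∧ σ ≤ (1 - η)⁻¹ • ω := by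
  have hc : (0 : ℝ) < Fintype.card C := by exact_mod_cast Fintype.card_pos
  have h1' : 0 < 1 - η := by linarith
  have hd : ((η / Fintype.card C) • (1 : Matrix C C ℂ)).PosDef := PosDef.one.smul (div_pos h0 hc)
  have hpos : ((1 - η) • σ + (η / Fintype.card C) • (1 : Matrix C C ℂ)).PosDef :=
    PosDef.posSemidef_add (hσ.1.smul h1'.le) hd
  refine ⟨_, ⟨hpos.posSemidef, ?_⟩, hpos, ?_⟩
  · rw [rtr_add, rtr_smul, rtr_smul, rtr_one, div_mul_cancel₀ _ hc.ne']
    nlinarith [hσ.2]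
  · rw [smul_add, inv_smul_smul₀ h1'.ne', le_add_iff_nonneg_right, nonneg_iff_posSemidef]
    exact hd.posSemidef.smul (inv_nonneg.2 h1'.le)

/-- The chain rule in terms of feasible values of the entropies. -/
theorem one_sub_sq_le {ρ ρ₃ : Matrix (A × B × C) (A × B × C) ℂ}
    {ρ₁ : Matrix ((A × B) × C) ((A × B) × C) ℂ} {ρ₂ : Matrix (B × C) (B × C) ℂ}
    {σ : Matrix C C ℂ} {ε ε₁ ε₂ ε₃ k a b : ℝ}
    (hε : 0 < ε) (hε₁ : 0 ≤ ε₁) (hε₂ : 0 ≤ ε₂) (hε₃ : 0 ≤ ε₃)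
    (hρ : ρ ∈ SubNormalized (A × B × C)) (hρ₁ : ρ₁ ∈ closeStates ε₁ (regroup ρ))
    (hρ₂ : ρ₂ ∈ closeStates ε₂ (trFst ρ)) (hρ₃ : ρ₃ ∈ closeStates ε₃ ρ)
    (hsum : ε + ε₁ + 2 * ε₂ + ε₃ + 2 * Real.sqrt (1 - rtr ρ) ≤ 1)
    (hk : 0 ≤ k) (hσ : σ ∈ SubNormalized C)
    (hρσ : ρ₁ ≤ k • ((1 : Matrix (A × B) (A × B) ℂ) ⊗ₖ σ))
    (ha : ∀ τ ∈ SubNormalized (B × C), fidelity ρ₃ ((1 : Matrix A A ℂ) ⊗ₖ τ) ^ 2 ≤ a)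
    (hb : ∀ ω ∈ SubNormalized C, fidelity ρ₂ ((1 : Matrix B B ℂ) ⊗ₖ ω) ^ 2 ≤ b) :
    1 - (ε + ε₁ + 2 * ε₂ + ε₃ + 2 * Real.sqrt (1 - rtr ρ)) ^ 2 ≤
      k * (b / (1 - Real.sqrt (1 - ε ^ 2))) * a := by
  -- On an empty index type the trace is 0, and then `hsum` would read 2 plus nonnegative terms ≤ 1.
  have hne : Nonempty (A × B × C) := by
    by_contra h
    rw [not_nonempty_iff] at h
    have : rtr ρ = 0 := by simp [rtr, trace]
    rw [this] at hsum
    simp only [sub_zero, Real.sqrt_one] at hsum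
    linarith
  obtain ⟨x⟩ := hne
  have : Nonempty C := ⟨x.2.2⟩
  have : Nonempty (B × C) := ⟨x.2⟩
  have e : (regroup ρ).submatrix (Equiv.prodAssoc A B C).symm (Equiv.prodAssoc A B C).symm = ρ := by
    ext i j
    simp [regroup]
  have hρ₁' := submatrix_mem_closeStates (Equiv.prodAssoc A B C).symm
    (submatrix_nonneg (SubNormalized.nonneg hρ) (Equiv.prodAssoc A B C)) hρ₁
  change _ ∈ closeStates ε₁ ((regroup ρ).submatrix _ _) at hρ₁'
  rw [e] at hρ₁'
  have hle : ρ₁.submatrix (Equiv.prodAssoc A B C).symm (Equiv.prodAssoc A B C).symm ≤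
      k • ((1 : Matrix A A ℂ) ⊗ₖ ((1 : Matrix B B ℂ) ⊗ₖ σ)) := by
    have h := submatrix_nonneg (sub_nonneg.2 hρσ) (Equiv.prodAssoc A B C).symm
    rw [← kronecker_assoc, one_kronecker_one, ← sub_nonneg]
    exact h
  -- One parameter η regularises both σ and the compressed operator; then η tends to 0 from above.
  have key : ∀ η : ℝ, 0 < η → η < 1 →
      1 - (ε + ε₁ + 2 * ε₂ + ε₃ + 2 * Real.sqrt (1 - rtr ρ)) ^ 2 ≤
        k * (1 - η)⁻¹ * (b / (1 - Real.sqrt (1 - ε ^ 2)) + η * Fintype.card (B × C)) * a := by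
    intro η h0 h1
    obtain ⟨ω, hω, hωpos, hσω⟩ := exists_posDef_subNormalized_le hσ h0 h1
    refine one_sub_sq_le_mul hε hε₁ hε₂ hε₃ hρ hρ₁' hρ₂ hρ₃ hsum (PosDef.one.kronecker hωpos)
      (mul_nonneg hk (inv_nonneg.2 (by linarith))) ?_ ha (hb ω hω) h0
    have h2 := one_kronecker_mono (X := A) (one_kronecker_mono (X := B) hσω)
    rw [kronecker_smul, kronecker_smul] at h2
    rw [mul_smul]
    exact hle.trans (smul_mono h2 hk)
  have hcont : ContinuousAt (fun η : ℝ =>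
      k * (1 - η)⁻¹ * (b / (1 - Real.sqrt (1 - ε ^ 2)) + η * Fintype.card (B × C)) * a) 0 := by
    have : ContinuousAt (fun η : ℝ => (1 - η)⁻¹) 0 :=
      (continuousAt_const.sub continuousAt_id).inv₀ (by simp)
    fun_prop
  have hlim := hcont.tendsto.mono_left (nhdsWithin_le_nhds (s := Set.Ioi (0 : ℝ)))
  have := ge_of_tendsto hlim (by
    filter_upwards [Ioo_mem_nhdsGT (zero_lt_one (α := ℝ))] with η hη
    exact key η hη.1 hη.2)
  simpa using this

end Tripartite

/-! ### Extended-real bookkeeping for entropies. -/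

section Entropy

variable {X Y : Type*} [Fintype X] [DecidableEq X] [Fintype Y] [DecidableEq Y]

theorem elog2_le_coe_iff {x r : ℝ} : elog2 x ≤ (r : EReal) ↔ x ≤ 2 ^ r := by
  unfold elog2
  split_ifs with h
  · simpa using h.trans (by positivity)
  · rw [EReal.coe_le_coe_iff, Real.logb_le_iff_le_rpow one_lt_two (not_le.1 h)]

theorem elog2_le_bot_iff {x : ℝ} : elog2 x ≤ ⊥ ↔ x ≤ 0 := by
  unfold elog2
  split_ifs with h <;> simp [h]

theorem Hmax_ne_top {ρ : Matrix (X × Y) (X × Y) ℂ} (hρ : 0 ≤ ρ) : Hmax ρ ≠ ⊤ := by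
  set M := rtr ρ * Fintype.card X with hM
  have hM0 : 0 ≤ M := mul_nonneg (rtr_nonneg hρ) (Nat.cast_nonneg _)
  refine ne_top_of_le_ne_top (EReal.coe_ne_top (Real.logb 2 (M + 1))) (iSup₂_le fun τ hτ => ?_)
  rw [HmaxRel, elog2_le_coe_iff, Real.rpow_logb two_pos (by norm_num) (by linarith)]
  have hτ0 : 0 ≤ (1 : Matrix X X ℂ) ⊗ₖ τ :=
    nonneg_iff_posSemidef.2 (PosSemidef.one.kronecker hτ.1)
  have h := pow_le_pow_left₀ (fidelity_nonneg _ _) (fidelity_le hρ hτ0) 2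
  rw [mul_pow, Real.sq_sqrt (rtr_nonneg hρ), Real.sq_sqrt (rtr_nonneg hτ0), rtr_one_kronecker] at h
  have h2 : rtr ρ * (Fintype.card X * rtr τ) ≤ M := by
    rw [hM, ← mul_assoc]
    exact mul_le_of_le_one_right hM0 hτ.2
  linarith

/-- The number a is 2^H_max, with a = 0 when the entropy is -∞; finiteness from above is
`Hmax_ne_top`. -/
theorem exists_Hmax_eq {ρ : Matrix (X × Y) (X × Y) ℂ} (hρ : 0 ≤ ρ) :
    ∃ a : ℝ, 0 ≤ a ∧ (∀ τ ∈ SubNormalized Y, fidelity ρ ((1 : Matrix X X ℂ) ⊗ₖ τ) ^ 2 ≤ a) ∧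
      (0 < a → Hmax ρ = (Real.logb 2 a : ℝ)) := by
  have hle : ∀ τ ∈ SubNormalized Y, HmaxRel ρ τ ≤ Hmax ρ := fun τ hτ =>
    le_iSup₂ (f := fun τ (_ : τ ∈ SubNormalized Y) => HmaxRel ρ τ) τ hτ
  have htop := Hmax_ne_top hρ
  generalize Hmax ρ = h at hle htop
  induction h with
  | top => exact absurd rfl htop
  | bot => exact ⟨0, le_rfl, fun τ hτ => elog2_le_bot_iff.1 (hle τ hτ), fun h => absurd h (lt_irrefl _)⟩
  | coe r =>
    refine ⟨2 ^ r, by positivity, fun τ hτ => elog2_le_coe_iff.1 (hle τ hτ), fun _ => ?_⟩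
    rw [Real.logb_rpow two_pos (by norm_num)]

theorem le_coe_add_biInf {ι : Type*} {s : Set ι} {u : ι → EReal} {l y : ℝ}
    (h : ∀ i ∈ s, (l : EReal) ≤ y + u i) : (l : EReal) ≤ y + ⨅ i ∈ s, u i := by
  rw [add_comm, ← EReal.sub_le_iff_le_add (by simp) (by simp)]
  refine le_iInf₂ fun i hi => ?_
  rw [EReal.sub_le_iff_le_add (by simp) (by simp), add_comm]
  exact h i hi

/-- A real lower bound and one member below ⊤ make the infimum real, so sums of infima never meet ⊤
+ ⊥. -/
theorem exists_biInf_eq_coe {ι : Type*} {s : Set ι} {u : ι → EReal} {l y : ℝ}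
    (h : ∀ i ∈ s, (l : EReal) ≤ y + u i) {i : ι} (hi : i ∈ s) (hui : u i ≠ ⊤) :
    ∃ r : ℝ, ⨅ i ∈ s, u i = r := by
  have h1 := le_coe_add_biInf h
  have h2 : ⨅ i ∈ s, u i ≠ ⊤ := ne_top_of_le_ne_top hui (iInf₂_le i hi)
  generalize ⨅ i ∈ s, u i = v at h1 h2
  induction v with
  | top => exact absurd rfl h2
  | bot => simp at h1
  | coe r => exact ⟨r, rfl⟩

theorem f_nonneg {ε : ℝ} (hε : 0 < ε) : 0 ≤ f ε := by
  have h : 0 < 1 - Real.sqrt (1 - ε ^ 2) := one_sub_sqrt_pos hε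
  refine Real.logb_nonneg one_lt_two ?_
  rw [le_div_iff₀ h]
  linarith [Real.sqrt_nonneg (1 - ε ^ 2)]

end Entropy

/-! ### The chain rule and its unsmoothed form. -/

section ChainRule

variable {A B C : Type*} [Fintype A] [DecidableEq A] [Fintype B] [DecidableEq B]
  [Fintype C] [DecidableEq C]

theorem chain_rule_of_le {ρ ρ₃ : Matrix (A × B × C) (A × B × C) ℂ}
    {ρ₁ : Matrix ((A × B) × C) ((A × B) × C) ℂ} {ρ₂ : Matrix (B × C) (B × C) ℂ}
    {σ : Matrix C C ℂ} {ε ε₁ ε₂ ε₃ l : ℝ}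
    (hε : 0 < ε) (hε₁ : 0 ≤ ε₁) (hε₂ : 0 ≤ ε₂) (hε₃ : 0 ≤ ε₃)
    (hρ : ρ ∈ SubNormalized (A × B × C)) (hρ₁ : ρ₁ ∈ closeStates ε₁ (regroup ρ))
    (hρ₂ : ρ₂ ∈ closeStates ε₂ (trFst ρ)) (hρ₃ : ρ₃ ∈ closeStates ε₃ ρ)
    (hsum : ε + ε₁ + 2 * ε₂ + ε₃ + 2 * Real.sqrt (1 - rtr ρ) < 1) (hσ : σ ∈ SubNormalized C)
    (hρσ : ρ₁ ≤ (2 : ℝ) ^ (-l) • ((1 : Matrix (A × B) (A × B) ℂ) ⊗ₖ σ)) :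
    ∃ h₂ h₃ : ℝ, Hmax ρ₂ = h₂ ∧ Hmax ρ₃ = h₃ ∧
      l ≤ h₃ + h₂ + (2 * f ε + Real.logb 2
        (1 / (1 - (ε + ε₁ + 2 * ε₂ + ε₃ + 2 * Real.sqrt (1 - rtr ρ)) ^ 2))) := by
  obtain ⟨a, ha0, ha, ha'⟩ := exists_Hmax_eq (SubNormalized.nonneg hρ₃.1)
  obtain ⟨b, hb0, hb, hb'⟩ := exists_Hmax_eq (SubNormalized.nonneg hρ₂.1)
  have hk : (0 : ℝ) < 2 ^ (-l) := by positivity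
  have h := one_sub_sq_le hε hε₁ hε₂ hε₃ hρ hρ₁ hρ₂ hρ₃ hsum.le hk.le hσ hρσ ha hb
  set S := ε + ε₁ + 2 * ε₂ + ε₃ + 2 * Real.sqrt (1 - rtr ρ) with hS
  have hS0 : 0 ≤ S := by positivity
  have hL : 0 < 1 - S ^ 2 := by nlinarith
  have hp : 0 < 1 - Real.sqrt (1 - ε ^ 2) := one_sub_sqrt_pos hε
  have hapos : 0 < a := by
    refine lt_of_le_of_ne ha0 fun h0 => ?_
    rw [← h0, mul_zero] at h
    linarith
  have hbpos : 0 < b := by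
    refine lt_of_le_of_ne hb0 fun h0 => ?_
    rw [← h0, zero_div, mul_zero, zero_mul] at h
    linarith
  refine ⟨_, _, hb' hbpos, ha' hapos, ?_⟩
  have hlog := Real.logb_le_logb_of_le one_lt_two hL h
  rw [Real.logb_mul (by positivity) hapos.ne', Real.logb_mul hk.ne' (by positivity),
    Real.logb_div hbpos.ne' hp.ne', Real.logb_rpow two_pos (by norm_num)] at hlog
  have hf : f ε = -Real.logb 2 (1 - Real.sqrt (1 - ε ^ 2)) := by
    rw [f, one_div, Real.logb_inv]
  -- The estimate yields a single f(ε); nonnegativity weakens it to the stated 2 f(ε).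
  have hf0 := f_nonneg hε
  rw [one_div, Real.logb_inv]
  linarith

theorem HminSmooth_le {ρ : Matrix (A × B × C) (A × B × C) ℂ} {ε₁ ε₂ ε₃ : ℝ}
    (hε₁ : 0 ≤ ε₁) (hε₂ : 0 ≤ ε₂) (hε₃ : 0 ≤ ε₃) (hρ : ρ ∈ SubNormalized (A × B × C))
    (hsum : ε₁ + 2 * ε₂ + ε₃ < 1 - 2 * Real.sqrt (1 - rtr ρ)) :
    HminSmooth ε₁ (regroup ρ) ≤
      HmaxSmooth ε₃ ρ + HmaxSmooth ε₂ (trFst ρ) + g ε₁ ε₂ ε₃ (rtr ρ) := by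
  refine iSup₂_le fun ρ₁ hρ₁ => iSup₂_le fun σ hσ => sSup_le ?_
  rintro _ ⟨l, rfl, hl⟩
  have hmem₂ := self_mem_closeStates hε₂ (trFst_mem_subNormalized hρ)
  have hmem₃ := self_mem_closeStates hε₃ hρ
  have hg : ∀ ρ₃ ∈ closeStates ε₃ ρ, ∀ ρ₂ ∈ closeStates ε₂ (trFst ρ), ∃ h₂ h₃ : ℝ,
      Hmax ρ₂ = h₂ ∧ Hmax ρ₃ = h₃ ∧ (l : EReal) ≤ ((h₃ + h₂ : ℝ) : EReal) + g ε₁ ε₂ ε₃ (rtr ρ) ∧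
      ∃ r : ℝ, g ε₁ ε₂ ε₃ (rtr ρ) = r := by
    intro ρ₃ hρ₃ ρ₂ hρ₂
    have hex := fun (ε : ℝ) (hε : ε ∈ Set.Ioo (0 : ℝ)
        (1 - ε₁ - 2 * ε₂ - ε₃ - 2 * Real.sqrt (1 - rtr ρ))) =>
      chain_rule_of_le hε.1 hε₁ hε₂ hε₃ hρ hρ₁ hρ₂ hρ₃ (by linarith [hε.2]) hσ hl
    obtain ⟨ε₀, hε₀⟩ : (Set.Ioo (0 : ℝ)
        (1 - ε₁ - 2 * ε₂ - ε₃ - 2 * Real.sqrt (1 - rtr ρ))).Nonempty :=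
      Set.nonempty_Ioo.2 (by linarith)
    obtain ⟨h₂, h₃, e₂, e₃, -⟩ := hex ε₀ hε₀
    have hall : ∀ ε ∈ Set.Ioo (0 : ℝ) (1 - ε₁ - 2 * ε₂ - ε₃ - 2 * Real.sqrt (1 - rtr ρ)),
        (l : EReal) ≤ ((h₃ + h₂ : ℝ) : EReal) + ((2 * f ε + Real.logb 2
          (1 / (1 - (ε + ε₁ + 2 * ε₂ + ε₃ + 2 * Real.sqrt (1 - rtr ρ)) ^ 2)) : ℝ) : EReal) := by
      intro ε hε
      obtain ⟨h₂', h₃', e₂', e₃', hle⟩ := hex ε hε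
      rw [e₂, EReal.coe_eq_coe_iff] at e₂'
      rw [e₃, EReal.coe_eq_coe_iff] at e₃'
      rw [← EReal.coe_add, EReal.coe_le_coe_iff, e₂', e₃']
      exact hle
    exact ⟨h₂, h₃, e₂, e₃, le_coe_add_biInf hall,
      exists_biInf_eq_coe hall hε₀ (EReal.coe_ne_top _)⟩
  -- The infima are taken one at a time, over `ε`, then ρ₂, then ρ₃, each shown to be real before
  -- the next.
  obtain ⟨_, _, -, -, -, r, hr⟩ := hg _ hmem₃ _ hmem₂
  have hmin₂ : ∀ ρ₃ ∈ closeStates ε₃ ρ, ∃ h₃ s : ℝ, Hmax ρ₃ = h₃ ∧ HmaxSmooth ε₂ (trFst ρ) = s ∧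
      (l : EReal) ≤ ((h₃ + r : ℝ) : EReal) + HmaxSmooth ε₂ (trFst ρ) := by
    intro ρ₃ hρ₃
    obtain ⟨h₂, h₃, e₂, e₃, -⟩ := hg _ hρ₃ _ hmem₂
    have hall : ∀ ρ₂ ∈ closeStates ε₂ (trFst ρ),
        (l : EReal) ≤ ((h₃ + r : ℝ) : EReal) + Hmax ρ₂ := by
      intro ρ₂ hρ₂
      obtain ⟨h₂', h₃', e₂', e₃', hle, -⟩ := hg _ hρ₃ _ hρ₂
      rw [e₃, EReal.coe_eq_coe_iff] at e₃'
      rw [e₂', e₃']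
      rw [hr] at hle
      norm_cast at hle ⊢
      linarith
    obtain ⟨s, hs⟩ := exists_biInf_eq_coe hall hmem₂ (by rw [e₂]; exact EReal.coe_ne_top _)
    exact ⟨h₃, s, e₃, hs, le_coe_add_biInf hall⟩
  obtain ⟨_, s, -, hs, -⟩ := hmin₂ _ hmem₃
  have hall : ∀ ρ₃ ∈ closeStates ε₃ ρ, (l : EReal) ≤ ((s + r : ℝ) : EReal) + Hmax ρ₃ := by
    intro ρ₃ hρ₃
    obtain ⟨h₃, s', e₃, -, hle⟩ := hmin₂ _ hρ₃
    rw [hs] at hle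
    rw [e₃]
    norm_cast at hle ⊢
    linarith
  have hfin := le_coe_add_biInf hall
  rw [hs, hr, add_assoc, ← EReal.coe_add, add_comm]
  exact hfin

/-- At ε = √3/2 one has √(1 - ε²) = 1/2, so f(ε) = 1 and the last logarithm is log 4 = 2. -/
theorem g_zero_le : g 0 0 0 1 ≤ 4 := by
  have h3 : Real.sqrt 3 ^ 2 = 3 := Real.sq_sqrt (by norm_num)
  have hs : Real.sqrt (1 - (Real.sqrt 3 / 2) ^ 2) = 1 / 2 := by
    rw [div_pow, h3, Real.sqrt_eq_iff_mul_self_eq_of_pos (by norm_num)]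
    norm_num
  have hmem : Real.sqrt 3 / 2 ∈ Set.Ioo (0 : ℝ) (1 - 0 - 2 * 0 - 0 - 2 * Real.sqrt (1 - 1)) := by
    refine ⟨by positivity, ?_⟩
    have : Real.sqrt 3 < 2 := by rw [Real.sqrt_lt' two_pos]; norm_num
    simp only [sub_self, Real.sqrt_zero]
    linarith
  refine (iInf₂_le _ hmem).trans ?_
  have h2 : Real.logb 2 2 = 1 := Real.logb_self_eq_one one_lt_two
  have h4 : Real.logb 2 4 = 2 := by
    rw [show (4 : ℝ) = 2 ^ (2 : ℝ) by norm_num, Real.logb_rpow two_pos (by norm_num)]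
  have e : 2 * f (Real.sqrt 3 / 2) + Real.logb 2
      (1 / (1 - (Real.sqrt 3 / 2 + 0 + 2 * 0 + 0 + 2 * Real.sqrt (1 - 1)) ^ 2)) = 4 := by
    rw [f, hs]
    simp only [sub_self, Real.sqrt_zero, mul_zero, add_zero, div_pow, h3]
    norm_num [h2, h4]
  rw [e]
  rfl

end ChainRule

end SmoothEntropy

end

theorem mainTheorem4 {A B C : Type*} [Fintype A] [DecidableEq A] [Fintype B] [DecidableEq B]
    [Fintype C] [DecidableEq C] (ρ : Matrix (A × B × C) (A × B × C) ℂ) :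
    (∀ ε' ε'' ε''' : ℝ, 0 ≤ ε' → 0 ≤ ε'' → 0 ≤ ε''' →
      ρ ∈ SmoothEntropy.SubNormalized (A × B × C) →
      ε' + 2 * ε'' + ε''' < 1 - 2 * Real.sqrt (1 - SmoothEntropy.rtr ρ) →
      SmoothEntropy.HminSmooth ε' (SmoothEntropy.regroup ρ) ≤
        SmoothEntropy.HmaxSmooth ε''' ρ
          + SmoothEntropy.HmaxSmooth ε'' (SmoothEntropy.trFst ρ)
          + SmoothEntropy.g ε' ε'' ε''' (SmoothEntropy.rtr ρ)) ∧
    (ρ ∈ SmoothEntropy.Normalized (A × B × C) →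
      SmoothEntropy.Hmin (SmoothEntropy.regroup ρ) ≤
        SmoothEntropy.Hmax ρ + SmoothEntropy.Hmax (SmoothEntropy.trFst ρ) + 4) := by
  refine ⟨fun ε₁ ε₂ ε₃ h₁ h₂ h₃ hρ hsum => SmoothEntropy.HminSmooth_le h₁ h₂ h₃ hρ hsum,
    fun hρ => ?_⟩
  have hsub : ρ ∈ SmoothEntropy.SubNormalized (A × B × C) := ⟨hρ.1, hρ.2.le⟩
  -- All smoothing parameters are 0. Each state lies in its own ball, so the smooth entropies bound
  -- the unsmoothed ones in the required directions.
  have h := SmoothEntropy.HminSmooth_le le_rfl le_rfl le_rfl hsub (by rw [hρ.2]; simp)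
  rw [hρ.2] at h
  have hmem := SmoothEntropy.self_mem_closeStates le_rfl
    (SmoothEntropy.submatrix_mem_subNormalized (Equiv.prodAssoc A B C) hsub)
  refine (le_iSup₂ (f := fun S (_ : S ∈ SmoothEntropy.closeStates 0 (SmoothEntropy.regroup ρ)) =>
    SmoothEntropy.Hmin S) _ hmem).trans (h.trans ?_)
  exact add_le_add (add_le_add
    (iInf₂_le _ (SmoothEntropy.self_mem_closeStates le_rfl hsub))
    (iInf₂_le _ (SmoothEntropy.self_mem_closeStates le_rfl
      (SmoothEntropy.trFst_mem_subNormalized hsub)))) SmoothEntropy.g_zero_le
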